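/- \textbf{Theorem.} Let $X$ be a connected, locally connected compact metrizable space and $f:X\to X$ a homeomorphism such that $(X,f)$ is a Smale space, i.e. there are a metric $d$ on $X$ compatible with the topology, constants $\lambda\in(0,1)$, $C>0$, and a local product structure on $X$ preserved by $f$, such that every point has an open rectangular neighbourhood $R\cong A\times B$ with $$d(f^n(y),f^n(z))\le C\lambda^n d(y,z)\quad (n\ge 0)\quad\text{for } y,z \text{ in a common plaque } A\times\{b\},$$ $$d(f^{-n}(y),f^{-n}(z))\le C\lambda^n d(y,z)\quad (n\ge 0)\quad\text{for } y,z \text{ in a common plaque } \{a\}\times B.$$ The stable leaf of $x$ is $W_+(x)=\{y : d(f^n(x),f^n(y))\to 0 \text{ as } n\to+\infty\}$, with its internal topology, in which the sets $\{z\in W_+(x) : d(f^k(y),f^k(z))<\varepsilon\ \text{for all } k\ge 0\}$, $\varepsilon>0$, form a neighbourhood basis of $y\in W_+(x)$; the unstable leaf $W_-(x)$ is the stable leaf of $x$ for $f^{-1}$. Suppose that $(X,f)$ has a splitting, i.e. a (surjective) covering map $\pi:M\to X$, where $M$ is a space with a global direct product structure $M=A\times B$, such that $\pi$ preserves the local product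 structures and for every $p=(a,b)\in M$ maps $A\times\{b\}$ homeomorphically onto $W_+(\pi(p))$ and $\{a\}\times B$ homeomorphically onto $W_-(\pi(p))$, with respect to the internal topologies. Let $G$ be its group of deck transformations: the homeomorphisms $g$ of $M$ that preserve the direct product structure and satisfy $\pi\circ g=\pi$. Suppose that $G\cong\mathbb{Z}^d$ for some $d\ge 0$, and fix such an isomorphism. Then $f$ has a lift, i.e. a homeomorphism $F:M\to M$ that preserves the direct product structure and satisfies $\pi\circ F=f\circ\pi$. For every lift $F$, let $\phi$ be the automorphism $\phi(g)=FgF^{-1}$ of $G\cong\mathbb{Z}^d$ induced by $F$. Then $\phi\in GL_d(\mathbb{Z})$ is hyperbolic (it has no complex eigenvalue of absolute value $1$), and $(X,f)$ is topologically conjugate to the automorphism of the torus $\mathbb{R}^d/\mathbb{Z}^d$ induced by $\phi$. In particular, $f$ has a fixed point. -/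

import Mathlib

open Set Filter Topology

namespace Smale

/-! ### Rectangles and local product structures -/

/-- A rectangle of a topological space `X`: a subset `carrier` with a direct product structure
`[y, z] = br y z` on it. (The values of `br` off the carrier are irrelevant.) For a product
`A × B` the operation is `[(a₁, b₁), (a₂, b₂)] = (a₁, b₂)`. -/
structure Rectangle (X : Type*) [TopologicalSpace X] where
  carrier : Set X
  br : X → X → X
  br_mem : ∀ y ∈ carrier, ∀ z ∈ carrier, br y z ∈ carrier
  continuousOn_br : ContinuousOn (fun p : X × X => br p.1 p.2) (carrier ×ˢ carrier)
  br_self : ∀ y ∈ carrier, br y y = y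
  br_left : ∀ x ∈ carrier, ∀ y ∈ carrier, ∀ z ∈ carrier, br (br x y) z = br x z
  br_right : ∀ x ∈ carrier, ∀ y ∈ carrier, ∀ z ∈ carrier, br x (br y z) = br x z

namespace Rectangle

variable {X : Type*} [TopologicalSpace X]

/-- The first (stable) plaque of `x`; it is `A × {b}` for `x = (a, b)` in `A × B`. -/
def plaque₁ (R : Rectangle X) (x : X) : Set X := {y | y ∈ R.carrier ∧ R.br x y = x}

/-- The second (unstable) plaque of `x`; it is `{a} × B` for `x = (a, b)` in `A × B`. -/
def plaque₂ (R : Rectangle X) (x : X) : Set X := {y | y ∈ R.carrier ∧ R.br x y = y}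

/-- Near every point of the space, the two operations agree wherever both are defined. -/
def Compatible (R S : Rectangle X) : Prop :=
  ∀ x : X, ∃ U ∈ 𝓝 x, ∀ y ∈ U ∩ (R.carrier ∩ S.carrier), ∀ z ∈ U ∩ (R.carrier ∩ S.carrier),
    R.br y z = S.br y z

end Rectangle

/-- A local product structure, given by a covering by open, pairwise compatible rectangles. -/
structure LocalProductStructure (X : Type*) [TopologicalSpace X] where
  charts : Set (Rectangle X)
  isOpen_charts : ∀ R ∈ charts, IsOpen R.carrier
  cover : ∀ x : X, ∃ R ∈ charts, x ∈ R.carrier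
  compatible : ∀ R ∈ charts, ∀ S ∈ charts, R.Compatible S

/-- An open rectangle that can be added to the covering defining the local product structure. -/
def LocalProductStructure.IsSubrectangle {X : Type*} [TopologicalSpace X]
    (L : LocalProductStructure X) (R : Rectangle X) : Prop :=
  IsOpen R.carrier ∧ ∀ S ∈ L.charts, R.Compatible S

/-- The map `f` preserves the local product structures: every point has a rectangular
neighbourhood `U` whose image is a rectangle, with `f [y, z] = [f y, f z]` on `U`. -/
def PreservesLocalProduct {X Y : Type*} [TopologicalSpace X] [TopologicalSpace Y]
    (L : LocalProductStructure X) (L' : LocalProductStructure Y) (f : X → Y) : Prop :=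
  ∀ x : X, ∃ (U : Rectangle X) (V : Rectangle Y), L.IsSubrectangle U ∧ L'.IsSubrectangle V ∧
    x ∈ U.carrier ∧ V.carrier = f '' U.carrier ∧
    ∀ y ∈ U.carrier, ∀ z ∈ U.carrier, f (U.br y z) = V.br (f y) (f z)

/-- A (global) direct product structure on a space. -/
structure DirectProductStructure (M : Type*) [TopologicalSpace M] extends Rectangle M where
  carrier_eq : carrier = univ

/-- The local product structure defined by a direct product structure. -/
def DirectProductStructure.toLocal {M : Type*} [TopologicalSpace M]
    (D : DirectProductStructure M) : LocalProductStructure M where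
  charts := {D.toRectangle}
  isOpen_charts := by
    rintro R rfl
    rw [D.carrier_eq]
    exact isOpen_univ
  cover x := ⟨D.toRectangle, rfl, by rw [D.carrier_eq]; exact mem_univ x⟩
  compatible := by
    rintro R rfl S rfl x
    exact ⟨univ, univ_mem, fun _ _ _ _ => rfl⟩

/-! ### Smale spaces -/

/-- `(X, f)`, with the local product structure `L`, is a Smale space: `X` is compact, and for
some metric `d` defining the topology of `X` the homeomorphism `f` preserves `L`, and every point
has a rectangular neighbourhood `R` such that `f` is exponentially contracting on the plaques
`P₁(R, ·)` and `f⁻¹` is exponentially contracting on the plaques `P₂(R, ·)`. -/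
def IsSmaleSpace {X : Type*} [t : TopologicalSpace X] (f : X ≃ₜ X)
    (L : LocalProductStructure X) : Prop :=
  CompactSpace X ∧ PreservesLocalProduct L L f ∧
  ∃ m : MetricSpace X, m.toUniformSpace.toTopologicalSpace = t ∧
  ∃ lam C : ℝ, 0 < lam ∧ lam < 1 ∧ 0 < C ∧
    ∀ x : X, ∃ R : Rectangle X, L.IsSubrectangle R ∧ x ∈ R.carrier ∧
      ∀ u ∈ R.carrier, ∀ n : ℕ,
        (∀ y ∈ R.plaque₁ u, ∀ z ∈ R.plaque₁ u,
          m.dist ((f ^ n) y) ((f ^ n) z) ≤ C * lam ^ n * m.dist y z) ∧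
        (∀ y ∈ R.plaque₂ u, ∀ z ∈ R.plaque₂ u,
          m.dist ((f⁻¹ ^ n) y) ((f⁻¹ ^ n) z) ≤ C * lam ^ n * m.dist y z)

/-- `x` and `y` are stably equivalent: `(fⁿ x, fⁿ y)` tends to the diagonal as `n → +∞`, i.e.
`d(fⁿ x, fⁿ y) → 0` for any metric `d` of the compact space `X`. -/
def StablyEquivalent {X : Type*} [TopologicalSpace X] (f : X ≃ₜ X) (x y : X) : Prop :=
  Tendsto (fun n : ℕ => ((f ^ n) x, (f ^ n) y)) atTop (𝓝ˢ (diagonal X))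

/-- The stable leaf of `x` for `f`. The unstable leaf of `x` for `f` is `StableLeaf f⁻¹ x`. It is
a type of its own since it carries its internal topology, not the one induced from `X`. -/
def StableLeaf {X : Type*} [TopologicalSpace X] (f : X ≃ₜ X) (x : X) : Type _ :=
  {y : X // StablyEquivalent f x y}

/-- The internal topology of a stable leaf `W`: basic neighbourhoods of `y ∈ W` are the local
stable sets `{z ∈ W | (fᵏ y, fᵏ z) ∈ V for all k ≥ 0}`, for neighbourhoods `V` of the diagonal.
It is the topology of the internal log-scale of `W`, see `StableLeaf.isOpen_iff_logScale`. -/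
instance {X : Type*} [TopologicalSpace X] (f : X ≃ₜ X) (x : X) :
    TopologicalSpace (StableLeaf f x) where
  IsOpen O := ∀ y ∈ O, ∃ V ∈ 𝓝ˢ (diagonal X), ∀ z : StableLeaf f x,
    (∀ k : ℕ, ((f ^ k) y.1, (f ^ k) z.1) ∈ V) → z ∈ O
  isOpen_univ := fun _ _ => ⟨univ, univ_mem, fun _ _ => mem_univ _⟩
  isOpen_inter := by
    intro s t hs ht y hy
    obtain ⟨V, hV, h⟩ := hs y hy.1
    obtain ⟨V', hV', h'⟩ := ht y hy.2
    exact ⟨V ∩ V', inter_mem hV hV', fun z hz =>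
      ⟨h z fun k => (hz k).1, h' z fun k => (hz k).2⟩⟩
  isOpen_sUnion := by
    intro S hS y hy
    obtain ⟨s, hs, hys⟩ := hy
    obtain ⟨V, hV, h⟩ := hS s hs y hys
    exact ⟨V, hV, fun z hz => ⟨s, hs, h z hz⟩⟩

/-- For a closed neighbourhood `U` of the diagonal as in the definition of expansivity, the
internal topology of a stable leaf is the one of the log-scale
`ℓ₊(y, z) = max {n | (fᵏ y, fᵏ z) ∈ U for all k ≥ -n}`, with basic neighbourhoods
`{z | ℓ₊(y, z) ≥ n}`. -/
theorem StableLeaf.isOpen_iff_logScale {X : Type*} [TopologicalSpace X] [CompactSpace X]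
    (f : X ≃ₜ X) (x : X) (U : Set (X × X)) (hU : U ∈ 𝓝ˢ (diagonal X)) (hcl : IsClosed U)
    (hexp : ∀ y z : X, (∀ k : ℤ, ((f ^ k) y, (f ^ k) z) ∈ U) → y = z)
    (O : Set (StableLeaf f x)) :
    IsOpen O ↔ ∀ y ∈ O, ∃ n : ℕ, ∀ z : StableLeaf f x,
      (∀ k : ℤ, -(n : ℤ) ≤ k → ((f ^ k) y.1, (f ^ k) z.1) ∈ U) → z ∈ O := by
  have hcont : ∀ k : ℤ, Continuous fun p : X × X => ((f ^ k) p.1, (f ^ k) p.2) := fun k =>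
    ((f ^ k).continuous.comp continuous_fst).prodMk ((f ^ k).continuous.comp continuous_snd)
  constructor
  · intro h y hy
    obtain ⟨V, hV, hz⟩ := h y hy
    obtain ⟨V', hV'o, hdV', hV'V⟩ := mem_nhdsSet_iff_exists.1 hV
    -- compactness: some finite intersection of the sets `f⁻ᵏ(U)` lies in `V'`
    have key : ∃ n : ℕ, (⋂ k ∈ Finset.Icc (-(n : ℤ)) n,
        (fun p : X × X => ((f ^ k) p.1, (f ^ k) p.2)) ⁻¹' U) ⊆ V' := by
      refine exists_subset_nhds_of_compactSpace
        (V := fun n : ℕ => ⋂ k ∈ Finset.Icc (-(n : ℤ)) n,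
          (fun p : X × X => ((f ^ k) p.1, (f ^ k) p.2)) ⁻¹' U) ?_ ?_ ?_
      · apply directed_of_isDirected_le
        intro a b hab
        apply biInter_mono
        · intro k hk
          simp only [Finset.coe_Icc, mem_Icc] at hk ⊢
          omega
        · intro _ _
          exact subset_rfl
      · intro n
        exact isClosed_biInter fun k _ => hcl.preimage (hcont k)
      · intro p hp
        have : p ∈ diagonal X := by
          apply hexp
          intro k
          have h1 := mem_iInter.1 hp k.natAbs
          have h2 := mem_iInter₂.1 h1 k (by simp only [Finset.mem_Icc]; omega)
          exact h2
        exact hV'o.mem_nhds (hdV' this)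
    obtain ⟨n, hn⟩ := key
    refine ⟨n, fun z hzU => hz z fun k => hV'V (hn ?_)⟩
    refine mem_iInter₂.2 fun i hi => ?_
    have hi' := Finset.mem_Icc.1 hi
    have := hzU (i + k) (by omega)
    rw [zpow_add, zpow_natCast] at this
    exact this
  · intro h y hy
    obtain ⟨n, hn⟩ := h y hy
    refine ⟨(fun p : X × X => ((f ^ (-(n : ℤ))) p.1, (f ^ (-(n : ℤ))) p.2)) ⁻¹' U, ?_, ?_⟩
    · apply ((hcont (-(n : ℤ))).tendsto_nhdsSet ?_) hU
      rintro ⟨a, b⟩ hab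
      simp only [mem_diagonal_iff] at hab ⊢
      rw [hab]
    · intro z hz
      refine hn z fun k hk => ?_
      obtain ⟨j, rfl⟩ : ∃ j : ℕ, k = -(n : ℤ) + j := ⟨(k + n).toNat, by omega⟩
      rw [zpow_add, zpow_natCast]
      exact hz j

/-! ### Splittings, deck transformations and lifts -/

/-- A splitting of the Smale space `(X, f)` with the local product structure `L`: a covering map
`π : M → X` of a space with a direct product structure that agrees with the local product
structures and maps the plaques of every `p ∈ M` homeomorphically onto the stable and the
unstable leaf of `π p` with their internal topologies. -/
structure IsSplitting {X M : Type*} [TopologicalSpace X] [TopologicalSpace M] (f : X ≃ₜ X)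
    (L : LocalProductStructure X) (D : DirectProductStructure M) (π : M → X) : Prop where
  isCoveringMap : IsCoveringMap π
  surjective : Function.Surjective π
  preserves : PreservesLocalProduct D.toLocal L π
  stable : ∀ p : M, ∃ e : D.plaque₁ p ≃ₜ StableLeaf f (π p),
    ∀ q : D.plaque₁ p, (e q).1 = π q
  unstable : ∀ p : M, ∃ e : D.plaque₂ p ≃ₜ StableLeaf f⁻¹ (π p),
    ∀ q : D.plaque₂ p, (e q).1 = π q

/-- The group of deck transformations: the homeomorphisms `g` of `M` that preserve the direct
product structure and satisfy `π ∘ g = π`. -/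
def deckGroup {X M : Type*} [TopologicalSpace M] (D : DirectProductStructure M) (π : M → X) :
    Subgroup (M ≃ₜ M) where
  carrier := {g | (∀ p q, g (D.br p q) = D.br (g p) (g q)) ∧ ∀ p, π (g p) = π p}
  mul_mem' := by
    rintro a b ⟨ha, ha'⟩ ⟨hb, hb'⟩
    refine ⟨fun p q => ?_, fun p => ?_⟩
    · change a (b _) = D.br (a (b p)) (a (b q))
      rw [hb, ha]
    · change π (a (b p)) = π p
      rw [ha', hb']
  one_mem' := ⟨fun _ _ => rfl, fun _ => rfl⟩
  inv_mem' := by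
    rintro a ⟨ha, ha'⟩
    refine ⟨fun p q => a.injective ?_, fun p => ?_⟩
    · change a (a.symm _) = a (D.br (a.symm p) (a.symm q))
      rw [ha]
      simp
    · change π (a.symm p) = π p
      rw [← ha' (a.symm p)]
      simp

/-- A lift of `f`: a homeomorphism `F` of `M` that preserves the direct product structure and
satisfies `π ∘ F = f ∘ π`. -/
structure IsLift {X M : Type*} [TopologicalSpace X] [TopologicalSpace M] (f : X ≃ₜ X)
    (D : DirectProductStructure M) (π : M → X) (F : M ≃ₜ M) : Prop where
  map_br : ∀ p q, F (D.br p q) = D.br (F p) (F q)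
  semiconj : ∀ p, π (F p) = f (π p)

theorem IsLift.conj_mem {X M : Type*} [TopologicalSpace X] [TopologicalSpace M] {f : X ≃ₜ X}
    {D : DirectProductStructure M} {π : M → X} {F : M ≃ₜ M} (hF : IsLift f D π F)
    {g : M ≃ₜ M} (hg : g ∈ deckGroup D π) : F * g * F⁻¹ ∈ deckGroup D π := by
  obtain ⟨h1, h2⟩ := hg
  refine ⟨fun p q => ?_, fun p => ?_⟩
  · change F (g (F.symm (D.br p q))) = D.br (F (g (F.symm p))) (F (g (F.symm q)))
    rw [← hF.map_br, ← h1]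
    congr 2
    apply F.injective
    rw [hF.map_br]
    simp
  · change π (F (g (F.symm p))) = π p
    rw [hF.semiconj, h2, ← hF.semiconj]
    simp

theorem IsLift.inv_conj_mem {X M : Type*} [TopologicalSpace X] [TopologicalSpace M] {f : X ≃ₜ X}
    {D : DirectProductStructure M} {π : M → X} {F : M ≃ₜ M} (hF : IsLift f D π F)
    {g : M ≃ₜ M} (hg : g ∈ deckGroup D π) : F⁻¹ * g * F ∈ deckGroup D π := by
  obtain ⟨h1, h2⟩ := hg
  refine ⟨fun p q => F.injective ?_, fun p => ?_⟩
  · change F (F.symm (g (F (D.br p q)))) = F (D.br (F.symm (g (F p))) (F.symm (g (F q))))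
    rw [hF.map_br, hF.map_br, Homeomorph.apply_symm_apply, Homeomorph.apply_symm_apply,
      Homeomorph.apply_symm_apply, h1]
  · change π (F.symm (g (F p))) = π p
    apply f.injective
    rw [← hF.semiconj, Homeomorph.apply_symm_apply, h2, hF.semiconj]

/-- The automorphism `φ` of the group of deck transformations induced by a lift `F` of `f`:
`φ g = F g F⁻¹`, i.e. `F (g p) = φ g (F p)`. -/
def inducedAut {X M : Type*} [TopologicalSpace X] [TopologicalSpace M] {f : X ≃ₜ X}
    {D : DirectProductStructure M} {π : M → X} {F : M ≃ₜ M} (hF : IsLift f D π F) :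
    deckGroup D π ≃* deckGroup D π where
  toFun g := ⟨F * g.1 * F⁻¹, hF.conj_mem g.2⟩
  invFun g := ⟨F⁻¹ * g.1 * F, hF.inv_conj_mem g.2⟩
  left_inv g := Subtype.ext (by simp [mul_assoc])
  right_inv g := Subtype.ext (by simp [mul_assoc])
  map_mul' g h := Subtype.ext (by simp [mul_assoc])

/-! ### Hyperbolic automorphisms of tori -/

/-- The automorphism of `ℤᵈ` that corresponds to an automorphism `φ` of `G` under `e : G ≃ ℤᵈ`. -/
def latticeAut {G : Type*} [Group G] {d : ℕ} (e : G ≃* Multiplicative (Fin d → ℤ))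
    (φ : G ≃* G) : (Fin d → ℤ) ≃+ (Fin d → ℤ) :=
  AddEquiv.toMultiplicative.symm ((e.symm.trans φ).trans e)

/-- The matrix of the automorphism of `ℤᵈ` that corresponds to `φ` under `e`. -/
def autMatrix {G : Type*} [Group G] {d : ℕ} (e : G ≃* Multiplicative (Fin d → ℤ))
    (φ : G ≃* G) : Matrix (Fin d) (Fin d) ℤ :=
  LinearMap.toMatrix' (latticeAut e φ).toAddMonoidHom.toIntLinearMap

/-- The endomorphism of the torus `ℝᵈ/ℤᵈ = (ℝ/ℤ)ᵈ` induced by an integral matrix `A`, that is, by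
the linear map `v ↦ A v` of `ℝᵈ`. -/
noncomputable def toralMap {d : ℕ} (A : Matrix (Fin d) (Fin d) ℤ) :
    UnitAddTorus (Fin d) → UnitAddTorus (Fin d) :=
  fun t i => ∑ j, A i j • t j

/-- A square integral matrix is hyperbolic: it is invertible over `ℤ` and has no complex
eigenvalue of absolute value one. -/
def IsHyperbolic {d : ℕ} (A : Matrix (Fin d) (Fin d) ℤ) : Prop :=
  IsUnit A ∧ ∀ μ ∈ spectrum ℂ (A.map (Int.cast : ℤ → ℂ)), ‖μ‖ ≠ 1

end Smale

/-!
Let `[x, y] = D.br x y` be the bracket of `M = A × B`, so that `[(a, b), (a', b')] = (a, b')`.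
Every statement about the stable direction has an unstable counterpart, obtained by interchanging
the two factors and replacing `f` by `f⁻¹`; the lemmas named `swap` make this substitution
available, so that only one half has to be proved.

*Lifting.* A homeomorphism `h` of `X` that commutes with `f` and preserves the local product
structure maps leaves to leaves, hence lifts to the two plaques of a point of `M`, hence to their
product `M`. The lift is compatible with `π` because the set of points where it is so is closed,
contains both plaques, and is locally closed under the bracket, and because the plaques are
connected: `f` contracts any two points of a stable leaf into a small connected set. For `h = f`
this is the lift of `f` (`SmaleMetric.exists_lift`); for `h = 1` it shows that the group `G ≅ ℤᵈ`
of deck transformations is transitive on the fibres of `π`. It acts freely and properly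
discontinuously with compact quotient, so there is an equivariant coarse coordinate `k : M → ℤᵈ`
(`IsCoarseCoord`), and a lift `F` is at bounded distance from its induced automorphism
(`IsCoarseCoord.exists_lift_bound`).

*Hyperbolicity.* For `g ∈ G` consider the map `x ↦ [g x, x]`, which is the action of `g` on the
first factor alone. As `G` is commutative this map commutes with `G`, so it displaces the coarse
coordinate by a bounded amount. This displacement is subadditive in `g`, and by the contraction of
the stable plaques a displacement of any size is brought below a fixed bound by sufficiently many
applications of `φ`. If `φ` had an eigenvalue `μ` with `|μ| = 1` then `1 - μʲ` could be made
arbitrarily small, and writing a lattice vector `v` near the rotation plane as `φʲ v` plus a vector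
near a much shorter point of the plane bounds the displacement of `v` by an arbitrarily small power
of `‖v‖` (`exists_bound_along_rotation`). The same holds for the second factor, and the two
displacements add up to at least `‖v‖`, which is a contradiction
(`SmaleMetric.eq_zero_of_rotation`).

*Conjugacy.* If `φ` is hyperbolic then `u ∘ σ - φ u = v` is uniquely solvable in bounded functions
for every bijection `σ` (`bijective_comp_sub_mulVec`). This corrects the coarse coordinate to a map
`Φ : M → ℝᵈ` at bounded distance from it with `Φ ∘ F = φ ∘ Φ`, and shows that `Φ` is equivariant.
It is continuous because zero is the only bounded orbit of `φ`, and injective because two points of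
`M` with orbits at bounded distance are equal. For surjectivity, split a lattice vector as `a + b`
into its expanding and contracting component. The image of `Φ` is invariant under the translations
by `a` and by `b`, since these are realized by deck transformations acting on one factor alone, and
`φ⁻ⁿ a + φⁿ b` can be made to approximate any given vector. So the image is dense; it is closed
since `Φ` is proper (`SmaleMetric.linearization_surjective`). Then `Φ` descends to the desired
homeomorphism of `X` and the torus.
-/

namespace Smale

variable {X M : Type*}

/-! ### Interchanging the two directions -/

namespace Rectangle

variable [TopologicalSpace X]

/-- The rectangle with its two directions interchanged. -/
def swap (R : Rectangle X) : Rectangle X where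
  carrier := R.carrier
  br y z := R.br z y
  br_mem y hy z hz := R.br_mem z hz y hy
  continuousOn_br := R.continuousOn_br.comp continuous_swap.continuousOn fun _ hp => ⟨hp.2, hp.1⟩
  br_self := R.br_self
  br_left x hx y hy z hz := R.br_right z hz y hy x hx
  br_right x hx y hy z hz := R.br_left z hz y hy x hx

theorem br_eq_left_iff (R : Rectangle X) {x y : X} (hx : x ∈ R.carrier) (hy : y ∈ R.carrier) :
    R.br y x = x ↔ R.br x y = y := by
  constructor <;> intro h
  · rw [← h, R.br_left y hy x hx y hy, R.br_self y hy]
  · rw [← h, R.br_left x hx y hy x hx, R.br_self x hx]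

theorem br_eq_right_iff (R : Rectangle X) {x y : X} (hx : x ∈ R.carrier) (hy : y ∈ R.carrier) :
    R.br y x = y ↔ R.br x y = x :=
  (R.swap.br_eq_left_iff hx hy).symm

theorem swap_plaque₁ (R : Rectangle X) {x : X} (hx : x ∈ R.carrier) :
    R.swap.plaque₁ x = R.plaque₂ x := by
  ext y
  exact and_congr_right fun hy => R.br_eq_left_iff hx hy

theorem swap_plaque₂ (R : Rectangle X) {x : X} (hx : x ∈ R.carrier) :
    R.swap.plaque₂ x = R.plaque₁ x := by
  ext y
  exact and_congr_right fun hy => R.br_eq_right_iff hx hy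

theorem Compatible.swap {R S : Rectangle X} (h : R.Compatible S) : R.swap.Compatible S.swap := by
  intro x
  obtain ⟨U, hU, H⟩ := h x
  exact ⟨U, hU, fun y hy z hz => H z hz y hy⟩

end Rectangle

namespace LocalProductStructure

variable [TopologicalSpace X]

/-- The local product structure with the two directions interchanged. -/
def swap (L : LocalProductStructure X) : LocalProductStructure X where
  charts := {R | R.swap ∈ L.charts}
  isOpen_charts R hR := L.isOpen_charts R.swap hR
  cover x := by
    obtain ⟨R, hR, hx⟩ := L.cover x
    exact ⟨R.swap, hR, hx⟩
  compatible R hR S hS := (L.compatible R.swap hR S.swap hS).swap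

theorem IsSubrectangle.swap {L : LocalProductStructure X} {R : Rectangle X}
    (h : L.IsSubrectangle R) : L.swap.IsSubrectangle R.swap :=
  ⟨h.1, fun S hS => (h.2 S.swap hS).swap⟩

/-- Any two subrectangles of a local product structure are compatible with each other, by way of
a chart around the point in question. -/
theorem IsSubrectangle.compatible {L : LocalProductStructure X} {R S : Rectangle X}
    (hR : L.IsSubrectangle R) (hS : L.IsSubrectangle S) : R.Compatible S := by
  intro x
  obtain ⟨T, hT, hx⟩ := L.cover x
  obtain ⟨U, hU, H⟩ := hR.2 T hT x
  obtain ⟨V, hV, K⟩ := hS.2 T hT x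
  refine ⟨U ∩ V ∩ T.carrier,
    inter_mem (inter_mem hU hV) ((L.isOpen_charts T hT).mem_nhds hx), ?_⟩
  rintro y ⟨⟨⟨hyU, hyV⟩, hyT⟩, hyR, hyS⟩ z ⟨⟨⟨hzU, hzV⟩, hzT⟩, hzR, hzS⟩
  rw [H y ⟨hyU, hyR, hyT⟩ z ⟨hzU, hzR, hzT⟩, K y ⟨hyV, hyS, hyT⟩ z ⟨hzV, hzS, hzT⟩]

end LocalProductStructure

theorem PreservesLocalProduct.swap {Y : Type*} [TopologicalSpace X] [TopologicalSpace Y]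
    {L : LocalProductStructure X} {L' : LocalProductStructure Y} {g : X → Y}
    (h : PreservesLocalProduct L L' g) : PreservesLocalProduct L.swap L'.swap g := by
  intro x
  obtain ⟨U, V, hU, hV, hx, hVU, H⟩ := h x
  exact ⟨U.swap, V.swap, hU.swap, hV.swap, hx, hVU, fun y hy z hz => H z hz y hy⟩

theorem PreservesLocalProduct.symm [TopologicalSpace X] {L : LocalProductStructure X}
    {f : X ≃ₜ X} (h : PreservesLocalProduct L L f) : PreservesLocalProduct L L (f⁻¹ : X ≃ₜ X) := by
  intro x
  obtain ⟨U, V, hU, hV, hx, hVU, H⟩ := h ((f⁻¹ : X ≃ₜ X) x)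
  have hfx : f ((f⁻¹ : X ≃ₜ X) x) = x := f.apply_symm_apply x
  have hinv : ∀ y, (f⁻¹ : X ≃ₜ X) (f y) = y := f.symm_apply_apply
  refine ⟨V, U, hV, hU, ?_, ?_, ?_⟩
  · rw [hVU]
    exact ⟨_, hx, hfx⟩
  · rw [hVU, image_image]
    simp [hinv]
  · rw [hVU]
    rintro _ ⟨y, hy, rfl⟩ _ ⟨z, hz, rfl⟩
    rw [hinv, hinv, ← H y hy z hz, hinv]

namespace DirectProductStructure

variable [TopologicalSpace M]

/-- The direct product structure with the two factors interchanged. -/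
def swap (D : DirectProductStructure M) : DirectProductStructure M where
  toRectangle := D.toRectangle.swap
  carrier_eq := D.carrier_eq

variable (D : DirectProductStructure M)

theorem mem_carrier (x : M) : x ∈ D.carrier := by
  rw [D.carrier_eq]
  exact mem_univ x

@[simp] theorem br_same (x : M) : D.br x x = x := D.br_self x (D.mem_carrier x)

@[simp] theorem br_br_left (x y z : M) : D.br (D.br x y) z = D.br x z :=
  D.br_left x (D.mem_carrier x) y (D.mem_carrier y) z (D.mem_carrier z)

@[simp] theorem br_br_right (x y z : M) : D.br x (D.br y z) = D.br x z :=
  D.br_right x (D.mem_carrier x) y (D.mem_carrier y) z (D.mem_carrier z)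

theorem continuous_br : Continuous fun p : M × M => D.br p.1 p.2 := by
  have h := D.continuousOn_br
  rwa [D.carrier_eq, univ_prod_univ, continuousOn_univ] at h

theorem mem_plaque₁ {x y : M} : y ∈ D.plaque₁ x ↔ D.br x y = x :=
  and_iff_right (D.mem_carrier y)

theorem mem_plaque₂ {x y : M} : y ∈ D.plaque₂ x ↔ D.br x y = y :=
  and_iff_right (D.mem_carrier y)

theorem br_eq_left_comm {x y : M} : D.br y x = x ↔ D.br x y = y :=
  D.br_eq_left_iff (D.mem_carrier x) (D.mem_carrier y)

theorem br_eq_right_comm {x y : M} : D.br y x = y ↔ D.br x y = x :=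
  D.br_eq_right_iff (D.mem_carrier x) (D.mem_carrier y)

theorem swap_plaque₁ (x : M) : D.swap.plaque₁ x = D.plaque₂ x :=
  D.toRectangle.swap_plaque₁ (D.mem_carrier x)

theorem swap_plaque₂ (x : M) : D.swap.plaque₂ x = D.plaque₁ x :=
  D.toRectangle.swap_plaque₂ (D.mem_carrier x)

theorem swap_toLocal : D.swap.toLocal = D.toLocal.swap := by
  have : ({D.toRectangle.swap} : Set (Rectangle M)) = {R | R.swap ∈ ({D.toRectangle} : Set _)} := by
    ext R
    simp only [mem_singleton_iff, mem_ofPred_eq]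
    constructor
    · rintro rfl
      rfl
    · intro h
      rw [← h]
      rfl
  unfold toLocal LocalProductStructure.swap
  congr

end DirectProductStructure

/-- The defining properties of a Smale space, with respect to the given metric and constants. -/
structure SmaleMetric [MetricSpace X] (f : X ≃ₜ X) (L : LocalProductStructure X)
    (lam C : ℝ) : Prop where
  preserves : PreservesLocalProduct L L f
  lam_pos : 0 < lam
  lam_lt_one : lam < 1
  C_pos : 0 < C
  exists_chart : ∀ x : X, ∃ R : Rectangle X, L.IsSubrectangle R ∧ x ∈ R.carrier ∧
    ∀ u ∈ R.carrier, ∀ n : ℕ,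
      (∀ y ∈ R.plaque₁ u, ∀ z ∈ R.plaque₁ u,
        dist ((f ^ n) y) ((f ^ n) z) ≤ C * lam ^ n * dist y z) ∧
      (∀ y ∈ R.plaque₂ u, ∀ z ∈ R.plaque₂ u,
        dist ((f⁻¹ ^ n) y) ((f⁻¹ ^ n) z) ≤ C * lam ^ n * dist y z)

theorem SmaleMetric.swap [MetricSpace X] {f : X ≃ₜ X} {L : LocalProductStructure X} {lam C : ℝ}
    (h : SmaleMetric f L lam C) : SmaleMetric f⁻¹ L.swap lam C where
  preserves := h.preserves.symm.swap
  lam_pos := h.lam_pos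
  lam_lt_one := h.lam_lt_one
  C_pos := h.C_pos
  exists_chart x := by
    obtain ⟨R, hR, hx, H⟩ := h.exists_chart x
    refine ⟨R.swap, hR.swap, hx, fun u hu n => ?_⟩
    rw [R.swap_plaque₁ hu, R.swap_plaque₂ hu, inv_inv]
    exact (H u hu n).symm

theorem IsSplitting.swap [TopologicalSpace X] [TopologicalSpace M] {f : X ≃ₜ X}
    {L : LocalProductStructure X} {D : DirectProductStructure M} {π : M → X}
    (h : IsSplitting f L D π) : IsSplitting f⁻¹ L.swap D.swap π where
  isCoveringMap := h.isCoveringMap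
  surjective := h.surjective
  preserves := by
    rw [D.swap_toLocal]
    exact h.preserves.swap
  stable p := by
    rw [D.swap_plaque₁]
    exact h.unstable p
  unstable p := by
    rw [D.swap_plaque₂, inv_inv]
    exact h.stable p

theorem IsLift.swap [TopologicalSpace X] [TopologicalSpace M] {f : X ≃ₜ X}
    {D : DirectProductStructure M} {π : M → X} {F : M ≃ₜ M} (h : IsLift f D π F) :
    IsLift f⁻¹ D.swap π F⁻¹ where
  map_br p q := by
    change F.symm (D.br q p) = D.br (F.symm q) (F.symm p)
    rw [F.symm_apply_eq, h.map_br]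
    simp
  semiconj p := by
    change π (F.symm p) = f.symm (π p)
    rw [f.eq_symm_apply, ← h.semiconj]
    simp

theorem deckGroup_swap [TopologicalSpace M] (D : DirectProductStructure M) (π : M → X) :
    deckGroup D.swap π = deckGroup D π := by
  ext g
  exact and_congr_left fun _ => ⟨fun h p q => h q p, fun h p q => h q p⟩

/-! ### Local coordinates and contraction -/

/-- A map preserving the local product structures is expressed by the brackets of any given
subrectangles around a point and its image, close to that point. -/
theorem PreservesLocalProduct.exists_nhds_map_br {Y : Type*} [TopologicalSpace X]
    [TopologicalSpace Y] {L : LocalProductStructure X} {L' : LocalProductStructure Y} {g : X → Y}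
    (h : PreservesLocalProduct L L' g) (hg : Continuous g) {x : X} {S : Rectangle X}
    {R : Rectangle Y} (hS : L.IsSubrectangle S) (hR : L'.IsSubrectangle R)
    (hxS : x ∈ S.carrier) (hxR : g x ∈ R.carrier) :
    ∃ O ∈ 𝓝 x, (∀ y ∈ O, y ∈ S.carrier ∧ g y ∈ R.carrier) ∧
      ∀ y ∈ O, ∀ z ∈ O, g (S.br y z) = R.br (g y) (g z) := by
  obtain ⟨U, V, hU, hV, hx, hVU, H⟩ := h x
  obtain ⟨N, hN, hNe⟩ := hU.compatible hS x
  obtain ⟨N', hN', hNe'⟩ := hV.compatible hR (g x)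
  have hR' : g ⁻¹' R.carrier ∈ 𝓝 x := hg.continuousAt (hR.1.mem_nhds hxR)
  refine ⟨N ∩ (U.carrier ∩ S.carrier) ∩ (g ⁻¹' N' ∩ g ⁻¹' R.carrier), ?_, ?_, ?_⟩
  · exact inter_mem (inter_mem hN (inter_mem (hU.1.mem_nhds hx) (hS.1.mem_nhds hxS)))
      (inter_mem (hg.continuousAt hN') hR')
  · rintro y ⟨⟨-, -, hy⟩, -, hy'⟩
    exact ⟨hy, hy'⟩
  · rintro y ⟨hy, hy1, hy2⟩ z ⟨hz, hz1, hz2⟩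
    have hy3 : g y ∈ V.carrier := hVU ▸ mem_image_of_mem g hy.2.1
    have hz3 : g z ∈ V.carrier := hVU ▸ mem_image_of_mem g hz.2.1
    rw [← hNe y hy z hz, H y hy.2.1 z hz.2.1, hNe' _ ⟨hy1, hy3, hy2⟩ _ ⟨hz1, hz3, hz2⟩]

theorem DirectProductStructure.isSubrectangle [TopologicalSpace M]
    (D : DirectProductStructure M) : D.toLocal.IsSubrectangle D.toRectangle := by
  refine ⟨?_, fun S hS => ?_⟩
  · rw [D.carrier_eq]
    exact isOpen_univ
  · rw [mem_singleton_iff.1 hS]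
    exact fun x => ⟨univ, univ_mem, fun _ _ _ _ => rfl⟩

section Contraction

variable [MetricSpace X] [TopologicalSpace M] {f : X ≃ₜ X} {L : LocalProductStructure X}
  {lam C : ℝ} {D : DirectProductStructure M} {π : M → X}

/-- The splitting map, in the brackets of a subrectangle. -/
theorem IsSplitting.exists_nhds_map_br (hπ : IsSplitting f L D π) {p : M} {R : Rectangle X}
    (hR : L.IsSubrectangle R) (hp : π p ∈ R.carrier) :
    ∃ O ∈ 𝓝 p, (∀ q ∈ O, π q ∈ R.carrier) ∧
      ∀ q ∈ O, ∀ s ∈ O, π (D.br q s) = R.br (π q) (π s) := by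
  obtain ⟨O, hO, h1, h2⟩ := hπ.preserves.exists_nhds_map_br hπ.isCoveringMap.continuous
    D.isSubrectangle hR (D.mem_carrier p) hp
  exact ⟨O, hO, fun q hq => (h1 q hq).2, h2⟩

/-- Close to any point of `M`, the map `f` contracts the first plaques exponentially. -/
theorem SmaleMetric.exists_nhds_contracting (hf : SmaleMetric f L lam C)
    (hπ : IsSplitting f L D π) (p : M) :
    ∃ O ∈ 𝓝 p, ∀ q ∈ O, ∀ s ∈ O, D.br q s = q → ∀ n : ℕ,
      dist ((f ^ n) (π q)) ((f ^ n) (π s)) ≤ C * lam ^ n * dist (π q) (π s) := by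
  obtain ⟨R, hR, hp, H⟩ := hf.exists_chart (π p)
  obtain ⟨O, hO, h1, h2⟩ := hπ.exists_nhds_map_br hR hp
  refine ⟨O, hO, fun q hq s hs hqs n => ?_⟩
  refine (H (π q) (h1 q hq) n).1 _ ⟨h1 q hq, R.br_self _ (h1 q hq)⟩ _ ⟨h1 s hs, ?_⟩
  rw [← h2 q hq s hs, hqs]

/-- The unstable half of expansivity: two points of a small second plaque whose forward orbits
stay close are equal. Their orbits stay in a common second plaque of some chart, on which the
inverse of `f` is contracting. -/
theorem SmaleMetric.exists_expansive [CompactSpace X] (hf : SmaleMetric f L lam C)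
    (hπ : IsSplitting f L D π) :
    ∃ ε > 0, ∀ p : M, ∃ O ∈ 𝓝 p, ∀ q ∈ O, ∀ s ∈ O, D.br q s = s →
      (∀ k : ℕ, dist ((f ^ k) (π q)) ((f ^ k) (π s)) < ε) → π q = π s := by
  choose R hR hxR hc using hf.exists_chart
  choose O hO hOmem hObr using fun x => hf.preserves.exists_nhds_map_br f.continuous
    (hR x) (hR (f x)) (hxR x) (hxR (f x))
  obtain ⟨t, ht⟩ := CompactSpace.elim_nhds_subcover (fun x => interior (O x))
    fun x => interior_mem_nhds.2 (hO x)
  choose N hN hNe using fun x x' => (hR x).compatible (hR x')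
  obtain ⟨ε₁, hε₁, hL₁⟩ := lebesgue_number_lemma_of_metric (isCompact_univ (X := X))
    (c := fun x : t => interior (O x)) (fun x => isOpen_interior) (by
      intro y _
      have hy : y ∈ ⋃ x ∈ t, interior (O x) := ht.symm ▸ mem_univ y
      obtain ⟨x, hx, hy⟩ := mem_iUnion₂.1 hy
      exact mem_iUnion.2 ⟨⟨x, hx⟩, hy⟩)
  -- near every point, the finitely many charts in use have the same bracket
  have hNN : ∀ w, (⋂ x ∈ t, ⋂ x' ∈ t, N (f x) x' w) ∈ 𝓝 w := fun w =>
    (biInter_finset_mem t).2 fun x _ => (biInter_finset_mem t).2 fun x' _ => hN _ _ _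
  obtain ⟨ε₂, hε₂, hL₂⟩ := lebesgue_number_lemma_of_metric (isCompact_univ (X := X))
    (c := fun w => interior (⋂ x ∈ t, ⋂ x' ∈ t, N (f x) x' w)) (fun x => isOpen_interior)
    fun w _ => mem_iUnion.2 ⟨w, mem_interior_iff_mem_nhds.2 (hNN w)⟩
  refine ⟨min ε₁ ε₂, lt_min hε₁ hε₂, fun p => ?_⟩
  obtain ⟨O', hO', hmem', hbr'⟩ := hπ.exists_nhds_map_br (hR (π p)) (hxR (π p))
  have hNp : (⋂ x ∈ t, N (π p) x (π p)) ∈ 𝓝 (π p) :=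
    (biInter_finset_mem t).2 fun x _ => hN _ _ _
  refine ⟨O' ∩ π ⁻¹' ⋂ x ∈ t, N (π p) x (π p),
    inter_mem hO' (hπ.isCoveringMap.continuous.continuousAt hNp), ?_⟩
  rintro q ⟨hq, hqN⟩ s ⟨hs, hsN⟩ hqs hclose
  have hcover : ∀ k : ℕ, ∃ x ∈ t, (f ^ k) (π q) ∈ O x ∧ (f ^ k) (π s) ∈ O x := by
    intro k
    obtain ⟨⟨x, hx⟩, H⟩ := hL₁ ((f ^ k) (π q)) (mem_univ _)
    refine ⟨x, hx, interior_subset (H (Metric.mem_ball_self hε₁)), interior_subset (H ?_)⟩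
    rw [Metric.mem_ball']
    exact (hclose k).trans_le (min_le_left _ _)
  have main : ∀ k : ℕ, ∃ x ∈ t, (f ^ k) (π q) ∈ O x ∧ (f ^ k) (π s) ∈ O x ∧
      (R x).br ((f ^ k) (π q)) ((f ^ k) (π s)) = (f ^ k) (π s) := by
    intro k
    induction k with
    | zero =>
      obtain ⟨x, hx, h1, h2⟩ := hcover 0
      refine ⟨x, hx, h1, h2, ?_⟩
      have h1' := (hOmem x _ h1).1
      have h2' := (hOmem x _ h2).1
      rw [pow_zero] at h1' h2' ⊢
      have := hNe (π p) x (π p) (π q) ⟨mem_iInter₂.1 hqN x hx, hmem' q hq, h1'⟩ (π s)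
        ⟨mem_iInter₂.1 hsN x hx, hmem' s hs, h2'⟩
      change (R x).br (π q) (π s) = π s
      rw [← this, ← hbr' q hq s hs, hqs]
    | succ k ih =>
      obtain ⟨x, hx, h1, h2, h3⟩ := ih
      obtain ⟨x', hx', h1', h2'⟩ := hcover (k + 1)
      refine ⟨x', hx', h1', h2', ?_⟩
      obtain ⟨w, hw⟩ := hL₂ ((f ^ (k + 1)) (π q)) (mem_univ _)
      have hq2 := interior_subset (hw (Metric.mem_ball_self hε₂))
      have hs2 := interior_subset (hw (Metric.mem_ball'.2
        ((hclose (k + 1)).trans_le (min_le_right _ _))))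
      have hq3 := mem_iInter₂.1 (mem_iInter₂.1 hq2 x hx) x' hx'
      have hs3 := mem_iInter₂.1 (mem_iInter₂.1 hs2 x hx) x' hx'
      have hstep : ∀ y, (f ^ (k + 1)) y = f ((f ^ k) y) := fun y => by rw [pow_succ']; rfl
      have h4 := hNe (f x) x' w _ ⟨hq3, hstep _ ▸ (hOmem x _ h1).2, (hOmem x' _ h1').1⟩ _
        ⟨hs3, hstep _ ▸ (hOmem x _ h2).2, (hOmem x' _ h2').1⟩
      rw [← h4, hstep, hstep, ← hObr x _ h1 _ h2, h3]
  have hdist : ∀ k : ℕ, dist (π q) (π s) ≤ C * lam ^ k * Metric.diam (univ : Set X) := by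
    intro k
    obtain ⟨x, hx, h1, h2, h3⟩ := main k
    have h1' := (hOmem x _ h1).1
    have := (hc x _ h1' k).2 _ ⟨h1', (R x).br_self _ h1'⟩ _ ⟨(hOmem x _ h2).1, h3⟩
    have hinv : ∀ y, (f⁻¹ ^ k) ((f ^ k) y) = y := fun y => by
      rw [inv_pow]
      exact (f ^ k).symm_apply_apply y
    rw [hinv, hinv] at this
    refine this.trans (mul_le_mul_of_nonneg_left ?_ ?_)
    · exact Metric.dist_le_diam_of_mem isCompact_univ.isBounded (mem_univ _) (mem_univ _)
    · exact mul_nonneg hf.C_pos.le (pow_nonneg hf.lam_pos.le k)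
  have hlim : Tendsto (fun k : ℕ => C * lam ^ k * Metric.diam (univ : Set X)) atTop (𝓝 0) := by
    simpa using ((tendsto_pow_atTop_nhds_zero_of_lt_one hf.lam_pos.le hf.lam_lt_one).const_mul
      C).mul_const (Metric.diam (univ : Set X))
  exact dist_le_zero.1 (ge_of_tendsto' hlim hdist)

end Contraction

/-! ### Leaves and plaques -/

section Leaves

variable [TopologicalSpace X]

theorem pow_apply_comm {f h : X ≃ₜ X} (hc : Commute h f) (n : ℕ) (x : X) :
    (f ^ n) (h x) = h ((f ^ n) x) :=
  (DFunLike.congr_fun (hc.pow_right n).eq x).symm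

theorem tendsto_prodMap_nhdsSet_diagonal {h : X → X} (hh : Continuous h) :
    Tendsto (Prod.map h h) (𝓝ˢ (diagonal X)) (𝓝ˢ (diagonal X)) :=
  (hh.prodMap hh).tendsto_nhdsSet fun _ hp => congrArg h hp

theorem StablyEquivalent.map {f h : X ≃ₜ X} (hc : Commute h f) {x y : X}
    (hxy : StablyEquivalent f x y) : StablyEquivalent f (h x) (h y) := by
  have := (tendsto_prodMap_nhdsSet_diagonal h.continuous).comp hxy
  refine this.congr fun n => ?_
  simp only [Function.comp, Prod.map, pow_apply_comm hc]

theorem stableLeaf_continuous_map {f h : X ≃ₜ X} (hc : Commute h f) {x x' : X}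
    (g : StableLeaf f x → StableLeaf f x') (hg : ∀ y, (g y).1 = h y.1) : Continuous g := by
  refine ⟨fun O hO y hy => ?_⟩
  obtain ⟨V, hV, H⟩ := hO (g y) hy
  refine ⟨Prod.map h h ⁻¹' V, tendsto_prodMap_nhdsSet_diagonal h.continuous hV, fun z hz => ?_⟩
  refine H (g z) fun k => ?_
  rw [hg, hg, pow_apply_comm hc, pow_apply_comm hc]
  exact hz k

/-- A homeomorphism commuting with `f` maps stable leaves onto stable leaves, homeomorphically
with respect to the internal topologies. -/
def stableLeafHomeo {f h : X ≃ₜ X} (hc : Commute h f) {x x' : X} (hx : x' = h x) :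
    StableLeaf f x ≃ₜ StableLeaf f x' where
  toFun y := ⟨h y.1, hx ▸ y.2.map hc⟩
  invFun y := ⟨(h⁻¹ : X ≃ₜ X) y.1, by
    have : x = (h⁻¹ : X ≃ₜ X) x' := by
      rw [hx]
      exact (h.symm_apply_apply x).symm
    rw [this]
    exact y.2.map hc.inv_left⟩
  left_inv y := Subtype.ext (h.symm_apply_apply y.1)
  right_inv y := Subtype.ext (h.apply_symm_apply y.1)
  continuous_toFun := stableLeaf_continuous_map hc _ fun _ => rfl
  continuous_invFun := stableLeaf_continuous_map hc.inv_left _ fun _ => rfl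

variable [TopologicalSpace M] {f : X ≃ₜ X} {L : LocalProductStructure X}
  {D : DirectProductStructure M} {π : M → X}

theorem IsSplitting.stablyEquivalent (hπ : IsSplitting f L D π) {p q : M} (h : D.br p q = p) :
    StablyEquivalent f (π p) (π q) := by
  obtain ⟨e, he⟩ := hπ.stable p
  rw [← he ⟨q, D.mem_plaque₁.2 h⟩]
  exact (e _).2

theorem IsSplitting.eq_of_plaque₁ (hπ : IsSplitting f L D π) {p y z : M} (hy : D.br p y = p)
    (hz : D.br p z = p) (h : π y = π z) : y = z := by
  obtain ⟨e, he⟩ := hπ.stable p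
  have : e ⟨y, D.mem_plaque₁.2 hy⟩ = e ⟨z, D.mem_plaque₁.2 hz⟩ :=
    Subtype.ext (by rw [he, he, h])
  exact congrArg Subtype.val (e.injective this)

theorem IsSplitting.eq_of_plaque₂ (hπ : IsSplitting f L D π) {p y z : M} (hy : D.br p y = y)
    (hz : D.br p z = z) (h : π y = π z) : y = z :=
  hπ.swap.eq_of_plaque₁ (D.br_eq_left_comm.2 hy) (D.br_eq_left_comm.2 hz) h

/-- A homeomorphism commuting with `f` lifts to the first plaques. -/
theorem IsSplitting.exists_plaque₁_homeo (hπ : IsSplitting f L D π) {h : X ≃ₜ X}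
    (hc : Commute h f) {p q : M} (hq : π q = h (π p)) :
    ∃ e : D.plaque₁ p ≃ₜ D.plaque₁ q, ∀ y, π (e y) = h (π y) := by
  obtain ⟨e₁, he₁⟩ := hπ.stable p
  obtain ⟨e₂, he₂⟩ := hπ.stable q
  refine ⟨(e₁.trans (stableLeafHomeo hc hq)).trans e₂.symm, fun y => ?_⟩
  rw [← he₂]
  simp only [Homeomorph.trans_apply, Homeomorph.apply_symm_apply]
  change h (e₁ y).1 = _
  rw [he₁]

theorem IsSplitting.exists_plaque₂_homeo (hπ : IsSplitting f L D π) {h : X ≃ₜ X}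
    (hc : Commute h f) {p q : M} (hq : π q = h (π p)) :
    ∃ e : D.plaque₂ p ≃ₜ D.plaque₂ q, ∀ y, π (e y) = h (π y) := by
  have := hπ.swap.exists_plaque₁_homeo hc.inv_right hq
  rwa [D.swap_plaque₁, D.swap_plaque₁] at this

end Leaves

/-! ### Local topology of the covering space -/

section Covering

variable [TopologicalSpace X] [TopologicalSpace M] {π : M → X}

theorem exists_local_section (hπ : IsLocalHomeomorph π) {p : M} {W : Set M} (hW : W ∈ 𝓝 p) :
    ∃ (σ : X → M) (V : Set X), V ∈ 𝓝 (π p) ∧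
      ∀ S ⊆ V, ContinuousOn σ S ∧ σ '' S ⊆ W ∧ (S ∈ 𝓝 (π p) → σ '' S ∈ 𝓝 p) := by
  obtain ⟨e, hp, rfl⟩ := hπ p
  refine ⟨e.symm, e.target ∩ e.symm ⁻¹' W, inter_mem (e.open_target.mem_nhds (e.map_source hp)) ?_,
    fun S hS => ⟨e.continuousOn_symm.mono fun x hx => (hS hx).1, ?_, fun hSn => ?_⟩⟩
  · apply (e.continuousAt_symm (e.map_source hp))
    rwa [e.left_inv hp]
  · rintro _ ⟨x, hx, rfl⟩
    exact (hS hx).2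
  · have := e.symm.image_mem_nhds (e.map_source hp) hSn
    rwa [e.left_inv hp] at this

theorem locallyCompactSpace_of_isLocalHomeomorph [LocallyCompactSpace X]
    (hπ : IsLocalHomeomorph π) : LocallyCompactSpace M := by
  refine ⟨fun p W hW => ?_⟩
  obtain ⟨σ, V, hV, H⟩ := exists_local_section hπ hW
  obtain ⟨S, hS, hSV, hSc⟩ := local_compact_nhds hV
  obtain ⟨h1, h2, h3⟩ := H S hSV
  exact ⟨σ '' S, h3 hS, h2, hSc.image_of_continuousOn h1⟩

theorem exists_isPreconnected_nhds [LocallyConnectedSpace X] (hπ : IsLocalHomeomorph π) {p : M}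
    {W : Set M} (hW : W ∈ 𝓝 p) : ∃ N ∈ 𝓝 p, N ⊆ W ∧ IsPreconnected N := by
  obtain ⟨σ, V, hV, H⟩ := exists_local_section hπ hW
  obtain ⟨S, hSV, hSo, hpS, hSc⟩ := locallyConnectedSpace_iff_subsets_isOpen_isConnected.1
    ‹LocallyConnectedSpace X› (π p) V hV
  obtain ⟨h1, h2, h3⟩ := H S hSV
  exact ⟨σ '' S, h3 (hSo.mem_nhds hpS), h2, hSc.isPreconnected.image _ h1⟩

theorem t2Space_of_isCoveringMap [T2Space X] (hπ : IsCoveringMap π) : T2Space M := by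
  refine ⟨fun p q hpq => ?_⟩
  by_cases h : π p = π q
  · exact hπ.isSeparatedMap p q h hpq
  · obtain ⟨u, v, hu, hv, hpu, hqv, huv⟩ := t2_separation h
    exact ⟨π ⁻¹' u, π ⁻¹' v, hu.preimage hπ.continuous, hv.preimage hπ.continuous, hpu, hqv,
      huv.preimage π⟩

end Covering

/-! ### Connectedness of the plaques -/

theorem StablyEquivalent.exists_dist_lt {X : Type*} [MetricSpace X] {f : X ≃ₜ X} {x y : X}
    (h : StablyEquivalent f x y) {ε : ℝ} (hε : 0 < ε) : ∃ n : ℕ, ∀ k : ℕ,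
      dist ((f ^ k) ((f ^ n) x)) ((f ^ k) ((f ^ n) y)) < ε := by
  have hV : {p : X × X | dist p.1 p.2 < ε} ∈ 𝓝ˢ (diagonal X) :=
    (isOpen_lt continuous_dist continuous_const).mem_nhdsSet.2 fun p hp => by
      rw [mem_diagonal_iff] at hp
      simpa [hp] using hε
  obtain ⟨n, hn⟩ := eventually_atTop.1 (h.eventually hV)
  refine ⟨n, fun k => ?_⟩
  have := hn (k + n) (by omega)
  rwa [pow_add] at this

section Metric

variable [MetricSpace X] [CompactSpace X] [TopologicalSpace M] {f : X ≃ₜ X}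
  {L : LocalProductStructure X} {lam C : ℝ} {D : DirectProductStructure M} {π : M → X}

/-- A point of the first plaque of `q` whose forward orbit follows the one of `q` closely is close
to `q` in `M`. Otherwise it would be a different point over the same place; the bracket of the
two contradicts the unstable half of expansivity. -/
theorem SmaleMetric.exists_nhds_stable_close (hf : SmaleMetric f L lam C)
    (hπ : IsSplitting f L D π) {p : M} {O : Set M} (hO : O ∈ 𝓝 p) :
    ∃ O' ∈ 𝓝 p, ∃ ε > 0, ∀ q ∈ O', ∀ q', D.br q q' = q →
      (∀ k : ℕ, dist ((f ^ k) (π q)) ((f ^ k) (π q')) < ε) → q' ∈ O := by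
  have hcont := hπ.isCoveringMap.continuous
  obtain ⟨ε₀, hε₀, HE⟩ := hf.exists_expansive hπ
  obtain ⟨OE, hOE, HE⟩ := HE p
  obtain ⟨OC, hOC, HC⟩ := hf.exists_nhds_contracting hπ p
  -- on `B` the distances are so small that stable pieces of orbits stay `ε₀ / 2`-close
  set B : Set M := π ⁻¹' Metric.ball (π p) (ε₀ / (4 * C)) with hB
  have hBn : B ∈ 𝓝 p :=
    hcont.continuousAt (Metric.ball_mem_nhds _ (div_pos hε₀ (mul_pos four_pos hf.C_pos)))
  set O₁ := O ∩ OE ∩ OC ∩ B with hO₁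
  have hO₁n : O₁ ∈ 𝓝 p := inter_mem (inter_mem (inter_mem hO hOE) hOC) hBn
  have hbr : (fun x : M × M => D.br x.1 x.2) ⁻¹' O₁ ∈ 𝓝 p ×ˢ 𝓝 p := by
    rw [← nhds_prod_eq]
    exact D.continuous_br.continuousAt (by simpa using hO₁n)
  obtain ⟨O₂, hO₂, hO₂br⟩ := mem_prod_self_iff.1 hbr
  have hsub : O₂ ⊆ O₁ := fun x hx => by simpa using hO₂br (mk_mem_prod hx hx)
  have him : π '' O₂ ∈ 𝓝 (π p) := hπ.isCoveringMap.isOpenMap.image_mem_nhds hO₂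
  obtain ⟨r, hr, hball⟩ := Metric.mem_nhds_iff.1 him
  refine ⟨O₂ ∩ π ⁻¹' Metric.ball (π p) (r / 2),
    inter_mem hO₂ (hcont.continuousAt (Metric.ball_mem_nhds _ (half_pos hr))),
    min (r / 2) (ε₀ / 2), lt_min (half_pos hr) (half_pos hε₀), ?_⟩
  rintro q ⟨hq, hqr⟩ q' hqq' hclose
  obtain ⟨q'', hq'', hq''π⟩ : π q' ∈ π '' O₂ := by
    apply hball
    have h0 := (hclose 0).trans_le (min_le_left _ _)
    rw [pow_zero] at h0
    change dist (π q) (π q') < r / 2 at h0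
    rw [mem_preimage, Metric.mem_ball] at hqr
    rw [Metric.mem_ball]
    linarith [dist_triangle_left (π q') (π p) (π q)]
  set s := D.br q'' q with hs
  have hsO : s ∈ O₁ := hO₂br (mk_mem_prod hq'' hq)
  have hqO := hsub hq
  have hqs : D.br q s = q := by simp [hs]
  have hcontr := HC q hqO.1.2 s hsO.1.2 hqs
  have hqs_dist : dist (π q) (π s) < ε₀ / (2 * C) := by
    have h1 := Metric.mem_ball.1 (hqO.2 : π q ∈ _)
    have h2 := Metric.mem_ball.1 (hsO.2 : π s ∈ _)
    have : ε₀ / (2 * C) = ε₀ / (4 * C) + ε₀ / (4 * C) := by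
      field_simp
      norm_num
    linarith [dist_triangle_right (π q) (π s) (π p)]
  have hforward : ∀ k : ℕ, dist ((f ^ k) (π q'')) ((f ^ k) (π s)) < ε₀ := by
    intro k
    have h1 : dist ((f ^ k) (π q)) ((f ^ k) (π s)) < ε₀ / 2 := by
      have hk : lam ^ k ≤ 1 := pow_le_one₀ hf.lam_pos.le hf.lam_lt_one.le
      have hC := hf.C_pos
      calc _ ≤ C * lam ^ k * dist (π q) (π s) := hcontr k
        _ ≤ C * 1 * dist (π q) (π s) := by gcongr
        _ < C * 1 * (ε₀ / (2 * C)) := by gcongr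
        _ = ε₀ / 2 := by field_simp
    have h2 := (hclose k).trans_le (min_le_right _ _)
    rw [hq''π]
    linarith [dist_triangle_left ((f ^ k) (π q')) ((f ^ k) (π s)) ((f ^ k) (π q))]
  have := HE q'' (hsub hq'').1.1.2 s hsO.1.1.2 (by simp [hs]) hforward
  rw [hπ.eq_of_plaque₁ hqq' hqs (hq''π.symm.trans this)]
  exact hsO.1.1.1

/-- A version of `SmaleMetric.exists_nhds_stable_close` that is uniform, by the compactness of
`X`, over all points of `X`, lifted to `M` in a suitable way. -/
theorem SmaleMetric.exists_finset_stable_close (hf : SmaleMetric f L lam C)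
    (hπ : IsSplitting f L D π) {O : M → Set M} (hO : ∀ p, O p ∈ 𝓝 p) :
    ∃ ε > 0, ∃ t : Finset M, ∀ x : X, ∃ p ∈ t, ∃ q, π q = x ∧ ∀ q', D.br q q' = q →
      (∀ k : ℕ, dist ((f ^ k) (π q)) ((f ^ k) (π q')) < ε) → q' ∈ O p := by
  classical
  choose σ hσ using hπ.surjective
  choose O' hO' ε hε H using fun p => hf.exists_nhds_stable_close hπ (hO p)
  obtain ⟨t, ht⟩ := CompactSpace.elim_nhds_subcover (fun x => π '' O' (σ x)) fun x => by
    have := hπ.isCoveringMap.isOpenMap.image_mem_nhds (hO' (σ x))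
    rwa [hσ] at this
  have hpos : ∃ δ > 0, ∀ x ∈ t, δ ≤ ε (σ x) := by
    obtain rfl | hne := t.eq_empty_or_nonempty
    · exact ⟨1, one_pos, by simp⟩
    · refine ⟨t.inf' hne fun x => ε (σ x), ?_, fun x hx => Finset.inf'_le _ hx⟩
      rw [gt_iff_lt, Finset.lt_inf'_iff]
      exact fun x _ => hε _
  obtain ⟨δ, hδ, hδε⟩ := hpos
  refine ⟨δ, hδ, t.image σ, fun x => ?_⟩
  have hx : x ∈ ⋃ x ∈ t, π '' O' (σ x) := ht.symm ▸ mem_univ x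
  obtain ⟨y, hy, q, hq, rfl⟩ := mem_iUnion₂.1 hx
  exact ⟨σ y, Finset.mem_image_of_mem σ hy, q, rfl, fun q' hq' hclose =>
    H (σ y) q hq q' hq' fun k => (hclose k).trans_le (hδε y hy)⟩

/-- The plaques are connected: iterating `f` brings two points of a stable leaf so close to each
other that they lie in a small connected piece of a plaque. -/
theorem SmaleMetric.isPreconnected_plaque₁ [LocallyConnectedSpace X]
    (hf : SmaleMetric f L lam C) (hπ : IsSplitting f L D π) (p : M) :
    IsPreconnected (D.plaque₁ p) := by
  choose N hN _ hNc using fun p : M =>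
    exists_isPreconnected_nhds hπ.isCoveringMap.isLocalHomeomorph (univ_mem (f := 𝓝 p))
  obtain ⟨ε, hε, t, ht⟩ := hf.exists_finset_stable_close hπ hN
  have hpp : p ∈ D.plaque₁ p := D.mem_plaque₁.2 (D.br_same p)
  refine isPreconnected_of_forall p fun q hq => ?_
  obtain ⟨n, hn⟩ := (hπ.stablyEquivalent (D.mem_plaque₁.1 hq)).exists_dist_lt hε
  obtain ⟨p₀, -, p', hp', H⟩ := ht ((f ^ n) (π p))
  obtain ⟨e, he⟩ := hπ.exists_plaque₁_homeo ((Commute.refl f).pow_left n) hp'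
  have hep : (e ⟨p, hpp⟩ : M) = p' := hπ.eq_of_plaque₁ (D.mem_plaque₁.1 (e ⟨p, hpp⟩).2)
    (D.br_same p') (by rw [he, hp'])
  have hmem : ∀ y : D.plaque₁ p', y.1 ∈ N p₀ → y ∈
      (fun x => (⟨D.br x p', D.mem_plaque₁.2 (by simp)⟩ : D.plaque₁ p')) '' N p₀ := fun y hy =>
    ⟨y, hy, Subtype.ext (show D.br y p' = y from
      D.br_eq_right_comm.2 (D.mem_plaque₁.1 y.2))⟩
  have hconn : IsPreconnected ((fun x =>
      (⟨D.br x p', D.mem_plaque₁.2 (by simp)⟩ : D.plaque₁ p')) '' N p₀) :=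
    (hNc p₀).image _ (Continuous.continuousOn (Continuous.subtype_mk
      (D.continuous_br.comp (continuous_id.prodMk continuous_const)) _))
  refine ⟨Subtype.val '' (e.symm '' _), ?_, ?_, ?_,
    (hconn.image e.symm e.symm.continuous.continuousOn).image Subtype.val
      continuous_subtype_val.continuousOn⟩
  · rintro _ ⟨y, -, rfl⟩
    exact y.2
  · refine ⟨_, ⟨e ⟨p, hpp⟩, hmem _ ?_, e.symm_apply_apply _⟩, rfl⟩
    rw [hep]
    exact H p' (D.br_same p') fun k => by simpa using hε
  · refine ⟨_, ⟨e ⟨q, hq⟩, hmem _ ?_, e.symm_apply_apply _⟩, rfl⟩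
    refine H _ (D.mem_plaque₁.1 (e ⟨q, hq⟩).2) fun k => ?_
    rw [hp', he]
    exact hn k

theorem SmaleMetric.isPreconnected_plaque₂ [LocallyConnectedSpace X]
    (hf : SmaleMetric f L lam C) (hπ : IsSplitting f L D π) (p : M) :
    IsPreconnected (D.plaque₂ p) := by
  rw [← D.swap_plaque₁]
  exact hf.swap.isPreconnected_plaque₁ hπ.swap p

/-! ### Lifting homeomorphisms -/

theorem exists_isCompact_isPreconnected_plaque₁ [LocallyConnectedSpace X]
    (hπ : IsCoveringMap π) {p q : M} (hconn : IsPreconnected (D.plaque₁ p))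
    (hq : D.br p q = p) :
    ∃ K ⊆ D.plaque₁ p, IsCompact K ∧ IsPreconnected K ∧ p ∈ K ∧ q ∈ K := by
  have := t2Space_of_isCoveringMap hπ
  have := locallyCompactSpace_of_isLocalHomeomorph hπ.isLocalHomeomorph
  set Z : Set M := {x | ∃ K ⊆ D.plaque₁ p, IsCompact K ∧ IsPreconnected K ∧ p ∈ K ∧
    D.br x p ∈ K} with hZ
  have hloc : ∀ x, ∃ N ∈ 𝓝 x, ∀ y ∈ N, ∀ z ∈ N, y ∈ Z → z ∈ Z := by
    intro x
    obtain ⟨W, hWc, hW⟩ := exists_compact_mem_nhds x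
    obtain ⟨N, hN, hNW, hNc⟩ := exists_isPreconnected_nhds hπ.isLocalHomeomorph hW
    have hcont : Continuous fun x => D.br x p :=
      D.continuous_br.comp (continuous_id.prodMk continuous_const)
    have hcl : closure N ⊆ W := closure_minimal hNW hWc.isClosed
    refine ⟨N, hN, ?_⟩
    rintro y hy z hz ⟨K, hK, hKc, hKp, hpK, hyK⟩
    refine ⟨K ∪ (fun x => D.br x p) '' closure N, union_subset hK ?_,
      hKc.union ((hWc.of_isClosed_subset isClosed_closure hcl).image hcont),
      hKp.union (D.br y p) hyK ⟨y, subset_closure hy, rfl⟩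
        (hNc.closure.image _ hcont.continuousOn), Or.inl hpK,
      Or.inr ⟨z, subset_closure hz, rfl⟩⟩
    rintro _ ⟨w, -, rfl⟩
    exact D.mem_plaque₁.2 (by simp)
  have hclopen : IsClopen Z := by
    refine ⟨⟨isOpen_iff_mem_nhds.2 fun x hx => ?_⟩, isOpen_iff_mem_nhds.2 fun x hx => ?_⟩
    · obtain ⟨N, hN, H⟩ := hloc x
      exact mem_of_superset hN fun y hy hyZ => hx (H y hy x (mem_of_mem_nhds hN) hyZ)
    · obtain ⟨N, hN, H⟩ := hloc x
      exact mem_of_superset hN fun y hy => H x (mem_of_mem_nhds hN) y hy hx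
  have hpp : p ∈ D.plaque₁ p := D.mem_plaque₁.2 (D.br_same p)
  have hpZ : p ∈ Z := ⟨{p}, singleton_subset_iff.2 hpp, isCompact_singleton,
    isPreconnected_singleton, rfl, D.br_same p⟩
  obtain ⟨K, h1, h2, h3, h4, h5⟩ :=
    hconn.subset_isClopen hclopen ⟨p, hpp, hpZ⟩ (D.mem_plaque₁.2 hq)
  rw [D.br_eq_right_comm.2 hq] at h5
  exact ⟨K, h1, h2, h3, h4, h5⟩

/-- A closed set that contains the two plaques of a point, and that is locally closed under the
bracket, is the whole space. Along a compact connected piece `K` of the first plaque, the set of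
heights `b` with `K × {b}` inside `S` is clopen. -/
theorem eq_univ_of_plaques_subset [LocallyConnectedSpace X] (hπ : IsCoveringMap π) {p : M}
    (h₁ : IsPreconnected (D.plaque₁ p)) (h₂ : IsPreconnected (D.plaque₂ p)) {S : Set M}
    (hS : IsClosed S) (hS₁ : D.plaque₁ p ⊆ S) (hS₂ : D.plaque₂ p ⊆ S)
    (hloc : ∀ x, ∃ N ∈ 𝓝 x, ∀ y ∈ N, ∀ z ∈ N, y ∈ S → z ∈ S → D.br y z ∈ S) : S = univ := by
  have := t2Space_of_isCoveringMap hπ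
  refine eq_univ_of_forall fun x => ?_
  obtain ⟨K, hK₁, hKc, hKp, hpK, hxK⟩ :=
    exists_isCompact_isPreconnected_plaque₁ hπ h₁ (q := D.br x p) (by simp)
  have hcont : ∀ a, Continuous fun b => D.br a b := fun a =>
    D.continuous_br.comp (continuous_const.prodMk continuous_id)
  set T : Set M := {b | ∀ a ∈ K, D.br a b ∈ S} with hT
  have hTclosed : IsClosed T := by
    have : T = ⋂ a ∈ K, (fun b => D.br a b) ⁻¹' S := by
      ext b
      simp [hT]
    rw [this]
    exact isClosed_biInter fun a _ => hS.preimage (hcont a)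
  have hTopen : IsOpen T := by
    refine isOpen_iff_mem_nhds.2 fun b hb => ?_
    have key : ∀ᶠ b' in 𝓝 b, ∀ a ∈ K,
        ∀ᶠ a' in 𝓝[K] a, (D.br a b' ∈ S ↔ D.br a' b' ∈ S) := by
      refine hKc.eventually_forall_of_forall_eventually fun a ha => ?_
      obtain ⟨N, hN, H⟩ := hloc (D.br a b)
      obtain ⟨u, hu, v, hv, huv⟩ := mem_nhds_prod_iff.1 (D.continuous_br.continuousAt
        (x := (a, b)) hN)
      rw [nhds_prod_eq]
      filter_upwards [prod_mem_prod hv (eventually_mem_nhds_iff.2 hu)]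
      rintro ⟨b', a'⟩ ⟨hb', ha'⟩
      have hbv := mem_of_mem_nhds hv
      have step : ∀ a₁ ∈ u, ∀ a₂ ∈ u, a₂ ∈ K → D.br a₁ b' ∈ S → D.br a₂ b' ∈ S := by
        intro a₁ h1 a₂ h2 h2K hS1
        have := H (D.br a₂ b) (huv (mk_mem_prod h2 hbv)) (D.br a₁ b') (huv (mk_mem_prod h1 hb'))
          (hb a₂ h2K) hS1
        simpa using this
      by_cases ha'K : a' ∈ K
      · filter_upwards [mem_nhdsWithin_of_mem_nhds ha', self_mem_nhdsWithin] with a₁ h1 h1K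
        exact ⟨step a' (mem_of_mem_nhds ha') a₁ h1 h1K, step a₁ h1 a' (mem_of_mem_nhds ha') ha'K⟩
      · have : 𝓝[K] a' = ⊥ := by
          rw [← notMem_closure_iff_nhdsWithin_eq_bot, hKc.isClosed.closure_eq]
          exact ha'K
        simp [this]
    filter_upwards [key] with b' hb' a ha
    have hp : D.br p b' ∈ S := hS₂ (D.mem_plaque₂.2 (by simp))
    have := hKp.induction₂ (fun a a' => (D.br a b' ∈ S ↔ D.br a' b' ∈ S)) hb'
      (fun _ _ _ _ _ _ h h' => h.trans h') (fun _ _ _ _ h => h.symm) hpK ha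
    exact this.1 hp
  have hpT : p ∈ T := fun a ha => by
    rw [D.br_eq_right_comm.2 (D.mem_plaque₁.1 (hK₁ ha))]
    exact hS₁ (hK₁ ha)
  have := h₂.subset_isClopen ⟨hTclosed, hTopen⟩ ⟨p, D.mem_plaque₂.2 (D.br_same p), hpT⟩
    (D.mem_plaque₂.2 (show D.br p (D.br p x) = D.br p x by simp)) _ hxK
  simpa using this

/-- The space is the product of the two plaques of any of its points. -/
def DirectProductStructure.homeoPlaques (D : DirectProductStructure M) (p : M) :
    M ≃ₜ D.plaque₁ p × D.plaque₂ p where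
  toFun x := (⟨D.br x p, D.mem_plaque₁.2 (by simp)⟩, ⟨D.br p x, D.mem_plaque₂.2 (by simp)⟩)
  invFun y := D.br y.1 y.2
  left_inv x := by simp
  right_inv := by
    rintro ⟨⟨y, hy⟩, z, hz⟩
    rw [D.mem_plaque₁] at hy
    rw [D.mem_plaque₂] at hz
    ext
    · simpa using D.br_eq_right_comm.2 hy
    · simpa using hz
  continuous_toFun :=
    (Continuous.subtype_mk (D.continuous_br.comp (continuous_id.prodMk continuous_const)) _).prodMk
      (Continuous.subtype_mk (D.continuous_br.comp (continuous_const.prodMk continuous_id)) _)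
  continuous_invFun := D.continuous_br.comp
    ((continuous_subtype_val.comp continuous_fst).prodMk
      (continuous_subtype_val.comp continuous_snd))

/-- A homeomorphism of `X` that commutes with `f` and preserves the local product structure lifts
to `M`, with a prescribed value at one point. -/
theorem SmaleMetric.exists_lift [LocallyConnectedSpace X] (hf : SmaleMetric f L lam C)
    (hπ : IsSplitting f L D π) {h : X ≃ₜ X} (hc : Commute h f)
    (hpres : PreservesLocalProduct L L h) {p q : M} (hq : π q = h (π p)) :
    ∃ F : M ≃ₜ M, IsLift h D π F ∧ F p = q := by
  obtain ⟨e₁, he₁⟩ := hπ.exists_plaque₁_homeo hc hq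
  obtain ⟨e₂, he₂⟩ := hπ.exists_plaque₂_homeo hc hq
  set F : M ≃ₜ M :=
    ((D.homeoPlaques p).trans (e₁.prodCongr e₂)).trans (D.homeoPlaques q).symm with hF
  have hFx : ∀ x, F x = D.br (e₁ ⟨D.br x p, D.mem_plaque₁.2 (by simp)⟩)
      (e₂ ⟨D.br p x, D.mem_plaque₂.2 (by simp)⟩) := fun x => rfl
  have hFbr : ∀ x y, F (D.br x y) = D.br (F x) (F y) := by
    intro x y
    rw [hFx, hFx, hFx]
    simp
  have hFp : F p = q := by
    have h1 : ∀ y, D.br p y = p → y = p → ∀ hy, (e₁ ⟨y, hy⟩ : M) = q := by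
      rintro y h rfl hy
      exact hπ.eq_of_plaque₁ (D.mem_plaque₁.1 (e₁ ⟨y, hy⟩).2) (D.br_same q) (by rw [he₁, hq])
    have h2 : ∀ y, D.br p y = y → y = p → ∀ hy, (e₂ ⟨y, hy⟩ : M) = q := by
      rintro y h rfl hy
      exact hπ.eq_of_plaque₂ (D.mem_plaque₂.1 (e₂ ⟨y, hy⟩).2) (D.br_same q) (by rw [he₂, hq])
    rw [hFx, h1 _ (by simp) (by simp), h2 _ (by simp) (by simp), D.br_same]
  have hF₁ : ∀ x (hx : D.br p x = p), F x = e₁ ⟨x, D.mem_plaque₁.2 hx⟩ := by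
    intro x hx
    have hx' := D.br_eq_right_comm.2 hx
    have h3 : F x = D.br (F x) q := by rw [← hFp, ← hFbr, hx']
    have h4 := D.br_eq_right_comm.2 (D.mem_plaque₁.1 (e₁ ⟨x, D.mem_plaque₁.2 hx⟩).2)
    rw [h3, hFx, D.br_br_left]
    simp only [hx']
    exact h4
  have hF₂ : ∀ x (hx : D.br p x = x), F x = e₂ ⟨x, D.mem_plaque₂.2 hx⟩ := by
    intro x hx
    have h3 : F x = D.br q (F x) := by rw [← hFp, ← hFbr, hx]
    have h4 := D.mem_plaque₂.1 (e₂ ⟨x, D.mem_plaque₂.2 hx⟩).2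
    rw [h3, hFx, D.br_br_right]
    simp only [hx]
    exact h4
  have hcont := hπ.isCoveringMap.continuous
  have huniv : {x | π (F x) = h (π x)} = univ := by
    refine eq_univ_of_plaques_subset hπ.isCoveringMap (hf.isPreconnected_plaque₁ hπ p)
      (hf.isPreconnected_plaque₂ hπ p)
      (isClosed_eq (hcont.comp F.continuous) (h.continuous.comp hcont)) ?_ ?_ ?_
    · intro x hx
      change π (F x) = h (π x)
      rw [hF₁ x (D.mem_plaque₁.1 hx), he₁]
    · intro x hx
      change π (F x) = h (π x)
      rw [hF₂ x (D.mem_plaque₂.1 hx), he₂]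
    · intro x
      by_cases hx : π (F x) = h (π x)
      · obtain ⟨R, hR, hxR, -⟩ := hf.exists_chart (π x)
        obtain ⟨R', hR', hxR', -⟩ := hf.exists_chart (h (π x))
        obtain ⟨O₁, hO₁, -, H₁⟩ := hπ.exists_nhds_map_br hR' (hx ▸ hxR' : π (F x) ∈ R'.carrier)
        obtain ⟨O₂, hO₂, -, H₂⟩ := hpres.exists_nhds_map_br h.continuous hR hR' hxR hxR'
        obtain ⟨O₃, hO₃, -, H₃⟩ := hπ.exists_nhds_map_br hR hxR
        refine ⟨F ⁻¹' O₁ ∩ (π ⁻¹' O₂ ∩ O₃), inter_mem (F.continuous.continuousAt hO₁)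
          (inter_mem (hcont.continuousAt hO₂) hO₃), ?_⟩
        rintro y ⟨hy1, hy2, hy3⟩ z ⟨hz1, hz2, hz3⟩ hy hz
        change π (F (D.br y z)) = h (π (D.br y z))
        change π (F y) = h (π y) at hy
        change π (F z) = h (π z) at hz
        rw [hFbr, H₁ _ hy1 _ hz1, hy, hz, ← H₂ _ hy2 _ hz2, H₃ _ hy3 _ hz3]
      · refine ⟨_, (isOpen_ne_fun (hcont.comp F.continuous)
          (h.continuous.comp hcont)).mem_nhds hx, fun y hy z _ hyS => absurd hyS hy⟩
  exact ⟨F, ⟨hFbr, fun x => eq_univ_iff_forall.1 huniv x⟩, hFp⟩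

end Metric

/-! ### The group of deck transformations -/

theorem PreservesLocalProduct.one [TopologicalSpace X] (L : LocalProductStructure X) :
    PreservesLocalProduct L L (1 : X ≃ₜ X) := by
  intro x
  obtain ⟨R, hR, hx⟩ := L.cover x
  have hR' : L.IsSubrectangle R := ⟨L.isOpen_charts R hR, L.compatible R hR⟩
  exact ⟨R, R, hR', hR', hx, (image_id R.carrier).symm, fun _ _ _ _ => rfl⟩

section Free

variable [TopologicalSpace X] [TopologicalSpace M] {f : X ≃ₜ X} {L : LocalProductStructure X}
  {D : DirectProductStructure M} {π : M → X}

theorem IsSplitting.deck_eq_one (hπ : IsSplitting f L D π) {g : deckGroup D π} {p : M}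
    (h : g.1 p = p) : g = 1 := by
  have hbr := g.2.1
  have hproj := g.2.2
  refine Subtype.ext (Homeomorph.ext fun x => ?_)
  have h1 : g.1 (D.br x p) = D.br x p := by
    refine hπ.eq_of_plaque₁ (p := p) ?_ (by simp) (hproj _)
    rw [hbr, h]
    simp
  have h2 : g.1 (D.br p x) = D.br p x := by
    refine hπ.eq_of_plaque₂ (p := p) ?_ (by simp) (hproj _)
    rw [hbr, h]
    simp
  have h3 : x = D.br (D.br x p) (D.br p x) := by simp
  change g.1 x = x
  conv_lhs => rw [h3, hbr, h1, h2]
  exact h3.symm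

theorem IsSplitting.deck_injective (hπ : IsSplitting f L D π) {g h : deckGroup D π} {p : M}
    (hgh : g.1 p = h.1 p) : g = h := by
  have : (h⁻¹ * g).1 p = p := by
    change h.1.symm (g.1 p) = p
    rw [hgh]
    exact h.1.symm_apply_apply p
  exact (inv_mul_eq_one.1 (hπ.deck_eq_one this)).symm

theorem IsSplitting.exists_compact_fundamental [T2Space X] [CompactSpace X]
    (hπ : IsSplitting f L D π) :
    ∃ K : Set M, IsCompact K ∧ ∀ x, ∃ p ∈ interior K, π p = x := by
  have := locallyCompactSpace_of_isLocalHomeomorph hπ.isCoveringMap.isLocalHomeomorph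
  choose σ hσ using hπ.surjective
  choose W hWc hW using fun p : M => exists_compact_mem_nhds p
  obtain ⟨t, ht⟩ := CompactSpace.elim_nhds_subcover (fun x => π '' interior (W (σ x))) fun x => by
    have := hπ.isCoveringMap.isOpenMap.image_mem_nhds (interior_mem_nhds.2 (hW (σ x)))
    rwa [hσ] at this
  refine ⟨⋃ x ∈ t, W (σ x), t.isCompact_biUnion fun x _ => hWc _, fun x => ?_⟩
  have hx : x ∈ ⋃ x ∈ t, π '' interior (W (σ x)) := ht.symm ▸ mem_univ x
  obtain ⟨y, hy, q, hq, rfl⟩ := mem_iUnion₂.1 hx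
  exact ⟨q, interior_mono (subset_biUnion_of_mem (u := fun x => W (σ x)) hy) hq, rfl⟩

end Free

section Deck

variable [MetricSpace X] [CompactSpace X] [LocallyConnectedSpace X] [TopologicalSpace M]
  {f : X ≃ₜ X} {L : LocalProductStructure X} {lam C : ℝ} {D : DirectProductStructure M}
  {π : M → X}

theorem SmaleMetric.exists_deck (hf : SmaleMetric f L lam C) (hπ : IsSplitting f L D π)
    {p q : M} (h : π q = π p) : ∃ g : deckGroup D π, g.1 p = q := by
  obtain ⟨F, hF, hFp⟩ := hf.exists_lift hπ (h := 1) (Commute.one_left f)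
    (PreservesLocalProduct.one L) h
  exact ⟨⟨F, hF.map_br, hF.semiconj⟩, hFp⟩

/-- The action of the group of deck transformations is properly discontinuous. -/
theorem SmaleMetric.finite_deck (hf : SmaleMetric f L lam C) (hπ : IsSplitting f L D π)
    {K K' : Set M} (hK : IsCompact K) (hK' : IsCompact K') :
    {g : deckGroup D π | ∃ x ∈ K, g.1 x ∈ K'}.Finite := by
  have hcont := hπ.isCoveringMap.continuous
  suffices H : {g : deckGroup D π | ∃ x : M, (x, g.1 x) ∈ K ×ˢ K'}.Finite by
    refine H.subset ?_
    rintro g ⟨x, hx, hgx⟩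
    exact ⟨x, hx, hgx⟩
  refine (hK.prod hK').induction_on
    (p := fun S => {g : deckGroup D π | ∃ x : M, (x, g.1 x) ∈ S}.Finite) ?_ ?_ ?_ ?_
  · simp
  · intro s t hst ht
    exact ht.subset fun g ⟨x, hx⟩ => ⟨x, hst hx⟩
  · intro s t hs ht
    refine (hs.union ht).subset ?_
    rintro g ⟨x, hx | hx⟩
    exacts [Or.inl ⟨x, hx⟩, Or.inr ⟨x, hx⟩]
  rintro ⟨x, y⟩ -
  by_cases hπxy : π y = π x
  · obtain ⟨g₀, rfl⟩ := hf.exists_deck hπ hπxy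
    obtain ⟨O, hO, hxO, hinj⟩ := hπ.isCoveringMap.isLocalHomeomorph.isLocallyInjective x
    refine ⟨O ×ˢ (g₀.1.symm ⁻¹' O), mem_nhdsWithin_of_mem_nhds (prod_mem_nhds (hO.mem_nhds hxO)
      (g₀.1.symm.continuous.continuousAt (hO.mem_nhds (by simpa using hxO)))),
      (finite_singleton g₀).subset ?_⟩
    rintro g ⟨z, hz, hgz⟩
    refine hπ.deck_injective (p := z) ?_
    have : g₀.1.symm (g.1 z) = z := hinj hgz hz ((g₀⁻¹ * g).2.2 z)
    rw [← this, Homeomorph.apply_symm_apply, this]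
  · obtain ⟨u, v, hu, hv, hxu, hyv, huv⟩ := t2_separation (Ne.symm hπxy)
    refine ⟨(π ⁻¹' u) ×ˢ (π ⁻¹' v), mem_nhdsWithin_of_mem_nhds (prod_mem_nhds
      ((hu.preimage hcont).mem_nhds hxu) ((hv.preimage hcont).mem_nhds hyv)), ?_⟩
    convert finite_empty (α := deckGroup D π)
    refine eq_empty_of_forall_notMem ?_
    rintro g ⟨z, hz, hgz⟩
    rw [mem_preimage, g.2.2] at hgz
    exact disjoint_left.1 huv hz hgz

end Deck

/-! ### Coarse coordinates -/

section Coarse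

variable [TopologicalSpace M] {D : DirectProductStructure M} {π : M → X} {d : ℕ}

/-- The vector of `ℤᵈ` that corresponds to a deck transformation. -/
def deckVec (e : deckGroup D π ≃* Multiplicative (Fin d → ℤ)) (g : deckGroup D π) : Fin d → ℤ :=
  (e g).toAdd

theorem deckVec_mul (e : deckGroup D π ≃* Multiplicative (Fin d → ℤ)) (g h : deckGroup D π) :
    deckVec e (g * h) = deckVec e g + deckVec e h := by
  simp [deckVec]

theorem deckVec_inv (e : deckGroup D π ≃* Multiplicative (Fin d → ℤ)) (g : deckGroup D π) :
    deckVec e g⁻¹ = -deckVec e g := by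
  simp [deckVec]

theorem deckVec_surjective (e : deckGroup D π ≃* Multiplicative (Fin d → ℤ)) :
    Function.Surjective (deckVec e) := fun v =>
  ⟨e.symm (Multiplicative.ofAdd v), by simp [deckVec]⟩

theorem deckVec_injective (e : deckGroup D π ≃* Multiplicative (Fin d → ℤ)) :
    Function.Injective (deckVec e) := fun _ _ h =>
  e.injective (Multiplicative.toAdd.injective h)

/-- A coarse coordinate on `M`: an equivariant map to `ℤᵈ`, not necessarily continuous, under
which bounded sets correspond to relatively compact ones. It identifies `M` with `ℤᵈ` on a large
scale. -/
structure IsCoarseCoord (e : deckGroup D π ≃* Multiplicative (Fin d → ℤ))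
    (k : M → Fin d → ℤ) : Prop where
  map_deck : ∀ (g : deckGroup D π) x, k (g.1 x) = deckVec e g + k x
  bounded_of_isCompact : ∀ Q : Set M, IsCompact Q → ∃ r : ℝ, ∀ x ∈ Q, ‖k x‖ ≤ r
  exists_isCompact : ∀ r : ℝ, ∃ Q : Set M, IsCompact Q ∧ ∀ x, ‖k x‖ ≤ r → x ∈ Q
  locally_bounded : ∃ r : ℝ, ∀ x, ∀ᶠ y in 𝓝 x, ‖k y - k x‖ ≤ r

/-- A function that is invariant under the deck transformations takes all its values on points
with coarse coordinate zero. -/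
theorem IsCoarseCoord.exists_deck_eq_zero {e : deckGroup D π ≃* Multiplicative (Fin d → ℤ)}
    {k : M → Fin d → ℤ} (hk : IsCoarseCoord e k) (x : M) : ∃ g : deckGroup D π, k (g.1 x) = 0 := by
  obtain ⟨g, hg⟩ := deckVec_surjective e (-k x)
  exact ⟨g, by rw [hk.map_deck, hg, neg_add_cancel]⟩

theorem IsCoarseCoord.map_deck_sub {e : deckGroup D π ≃* Multiplicative (Fin d → ℤ)}
    {k : M → Fin d → ℤ} (hk : IsCoarseCoord e k) (g : deckGroup D π) (x y : M) :
    k (g.1 x) - k (g.1 y) = k x - k y := by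
  rw [hk.map_deck, hk.map_deck, add_sub_add_left_eq_sub]

variable [MetricSpace X] [CompactSpace X] [LocallyConnectedSpace X]
  {f : X ≃ₜ X} {L : LocalProductStructure X} {lam C : ℝ}

theorem SmaleMetric.exists_isCoarseCoord (hf : SmaleMetric f L lam C)
    (hπ : IsSplitting f L D π) (e : deckGroup D π ≃* Multiplicative (Fin d → ℤ)) :
    ∃ k : M → Fin d → ℤ, IsCoarseCoord e k := by
  obtain ⟨K, hK, hKπ⟩ := hπ.exists_compact_fundamental
  choose σ hσK hσ using hKπ
  choose c hc using fun x => hf.exists_deck hπ (p := σ (π x)) (q := x) (hσ (π x)).symm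
  have hcg : ∀ (g : deckGroup D π) x, c (g.1 x) = g * c x := by
    intro g x
    refine hπ.deck_injective (p := σ (π x)) ?_
    have h1 := hc (g.1 x)
    rw [g.2.2] at h1
    rw [h1]
    change g.1 x = g.1 ((c x).1 (σ (π x)))
    rw [hc]
  have hbdd : ∀ Q : Set M, IsCompact Q → ∃ r : ℝ, ∀ x ∈ Q, ‖deckVec e (c x)‖ ≤ r := by
    intro Q hQ
    obtain ⟨r, hr⟩ := ((hf.finite_deck hπ hK hQ).image (deckVec e)).isBounded.exists_norm_le
    exact ⟨r, fun x hx => hr _ ⟨c x, ⟨σ (π x), interior_subset (hσK _), by rwa [hc]⟩, rfl⟩⟩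
  refine ⟨fun x => deckVec e (c x), ⟨fun g x => by rw [hcg, deckVec_mul], hbdd, fun r => ?_, ?_⟩⟩
  · have hfin : (deckVec e ⁻¹' Metric.closedBall 0 r).Finite :=
      ((isCompact_closedBall (0 : Fin d → ℤ) r).finite_of_discrete).preimage
        (deckVec_injective e).injOn
    refine ⟨⋃ g ∈ deckVec e ⁻¹' Metric.closedBall 0 r, g.1 '' K,
      hfin.isCompact_biUnion fun g _ => hK.image g.1.continuous, fun x hx => ?_⟩
    refine mem_iUnion₂.2 ⟨c x, ?_, σ (π x), interior_subset (hσK _), hc x⟩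
    rwa [mem_preimage, mem_closedBall_zero_iff]
  · obtain ⟨r, hr⟩ := hbdd K hK
    refine ⟨r + r, fun x => ?_⟩
    have hcont : ∀ᶠ y in 𝓝 x, (c x)⁻¹.1 y ∈ interior K := by
      refine (c x)⁻¹.1.continuous.continuousAt (isOpen_interior.mem_nhds ?_)
      have : (c x)⁻¹.1 x = σ (π x) := by
        change (c x).1.symm x = _
        rw [Homeomorph.symm_apply_eq, hc]
      rw [this]
      exact hσK _
    have hmem : ∀ y, (c x)⁻¹.1 y ∈ interior K → ‖-deckVec e (c x) + deckVec e (c y)‖ ≤ r := by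
      intro y hy
      rw [← deckVec_inv, ← deckVec_mul, ← hcg]
      exact hr _ (interior_subset hy)
    filter_upwards [hcont] with y hy
    have h1 := hmem y hy
    have h2 := hmem x hcont.self_of_nhds
    rw [← add_sub_add_left_eq_sub _ _ (-deckVec e (c x))]
    exact (norm_sub_le _ _).trans (add_le_add h1 h2)

end Coarse

/-! ### Coarse dynamics of a lift -/

section Swap

variable [TopologicalSpace M] {D : DirectProductStructure M} {π : M → X} {d : ℕ}

theorem latticeAut_deckVec (e : deckGroup D π ≃* Multiplicative (Fin d → ℤ))
    (φ : deckGroup D π ≃* deckGroup D π) (g : deckGroup D π) :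
    latticeAut e φ (deckVec e g) = deckVec e (φ g) := by
  change (e (φ (e.symm (e g)))).toAdd = _
  rw [MulEquiv.symm_apply_apply]
  rfl

/-- The identification of the group of deck transformations with `ℤᵈ`, for the structure with the
two directions interchanged. -/
def swapEquiv (e : deckGroup D π ≃* Multiplicative (Fin d → ℤ)) :
    deckGroup D.swap π ≃* Multiplicative (Fin d → ℤ) :=
  (MulEquiv.subgroupCongr (deckGroup_swap D π)).trans e

theorem IsCoarseCoord.swap {e : deckGroup D π ≃* Multiplicative (Fin d → ℤ)}
    {k : M → Fin d → ℤ} (hk : IsCoarseCoord e k) : IsCoarseCoord (swapEquiv e) k where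
  map_deck g x := hk.map_deck ⟨g.1, deckGroup_swap D π ▸ g.2⟩ x
  bounded_of_isCompact := hk.bounded_of_isCompact
  exists_isCompact := hk.exists_isCompact
  locally_bounded := hk.locally_bounded

theorem IsCoarseCoord.exists_br_bound {e : deckGroup D π ≃* Multiplicative (Fin d → ℤ)}
    {k : M → Fin d → ℤ} (hk : IsCoarseCoord e k) (r : ℝ) :
    ∃ r' : ℝ, ∀ x y, ‖k x - k y‖ ≤ r → ‖k x - k (D.br x y)‖ ≤ r' := by
  obtain ⟨Q, hQ, hkQ⟩ := hk.exists_isCompact 0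
  obtain ⟨Q', hQ', hkQ'⟩ := hk.exists_isCompact r
  obtain ⟨s, hs⟩ := hk.bounded_of_isCompact _ ((hQ.prod hQ').image D.continuous_br)
  refine ⟨s, fun x y hxy => ?_⟩
  obtain ⟨g, hg⟩ := hk.exists_deck_eq_zero x
  rw [← hk.map_deck_sub g, hg, zero_sub, norm_neg, g.2.1]
  refine hs _ ⟨(g.1 x, g.1 y), ⟨hkQ _ (by simp [hg]), hkQ' _ ?_⟩, rfl⟩
  rw [← hk.map_deck_sub g, hg, zero_sub, norm_neg] at hxy
  exact hxy

end Swap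

section Lift

variable [TopologicalSpace X] [TopologicalSpace M] {f f' : X ≃ₜ X} {D : DirectProductStructure M}
  {π : M → X} {F F' : M ≃ₜ M} {d : ℕ}

theorem IsLift.one (D : DirectProductStructure M) (π : M → X) : IsLift 1 D π 1 :=
  ⟨fun _ _ => rfl, fun _ => rfl⟩

theorem IsLift.mul (h : IsLift f D π F) (h' : IsLift f' D π F') :
    IsLift (f * f') D π (F * F') where
  map_br p q := by
    change F (F' (D.br p q)) = D.br (F (F' p)) (F (F' q))
    rw [h'.map_br, h.map_br]
  semiconj p := by
    change π (F (F' p)) = f (f' (π p))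
    rw [h.semiconj, h'.semiconj]

theorem IsLift.inv (h : IsLift f D π F) : IsLift f⁻¹ D π F⁻¹ :=
  ⟨fun p q => h.swap.map_br q p, h.swap.semiconj⟩

theorem IsLift.pow (h : IsLift f D π F) (n : ℕ) : IsLift (f ^ n) D π (F ^ n) := by
  induction n with
  | zero => exact IsLift.one D π
  | succ n ih =>
    rw [pow_succ, pow_succ]
    exact ih.mul h

theorem IsLift.zpow (h : IsLift f D π F) (n : ℤ) : IsLift (f ^ n) D π (F ^ n) := by
  obtain ⟨n, rfl | rfl⟩ := n.eq_nat_or_neg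
  · simpa using h.pow n
  · simpa using (h.pow n).inv

theorem IsLift.apply_deck (hF : IsLift f D π F) (g : deckGroup D π) (x : M) :
    F (g.1 x) = (inducedAut hF g).1 (F x) := by
  change _ = F (g.1 (F.symm (F x)))
  rw [F.symm_apply_apply]

theorem latticeAut_swap (e : deckGroup D π ≃* Multiplicative (Fin d → ℤ)) (hF : IsLift f D π F)
    (v : Fin d → ℤ) :
    latticeAut (swapEquiv e) (inducedAut hF.swap) v =
      (latticeAut e (inducedAut hF)).symm v := by
  rw [AddEquiv.eq_symm_apply]
  obtain ⟨g, rfl⟩ := deckVec_surjective (swapEquiv e) v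
  rw [latticeAut_deckVec]
  have hg : g.1 ∈ deckGroup D π := deckGroup_swap D π ▸ g.2
  have h1 : deckVec (swapEquiv e) (inducedAut hF.swap g) =
      deckVec e ⟨(inducedAut hF.swap g).1, deckGroup_swap D π ▸ (inducedAut hF.swap g).2⟩ := rfl
  have h2 : deckVec (swapEquiv e) g = deckVec e ⟨g.1, hg⟩ := rfl
  rw [h1, h2, latticeAut_deckVec]
  congr 1
  apply Subtype.ext
  change F * (F⁻¹ * g.1 * F⁻¹⁻¹) * F⁻¹ = g.1
  group

/-- On a large scale, a lift is the automorphism of `ℤᵈ` that it induces. -/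
theorem IsCoarseCoord.exists_lift_bound {e : deckGroup D π ≃* Multiplicative (Fin d → ℤ)}
    {k : M → Fin d → ℤ} (hk : IsCoarseCoord e k) (hF : IsLift f D π F) :
    ∃ C : ℝ, ∀ x, ‖k (F x) - latticeAut e (inducedAut hF) (k x)‖ ≤ C := by
  obtain ⟨Q, hQ, hkQ⟩ := hk.exists_isCompact 0
  obtain ⟨r, hr⟩ := hk.bounded_of_isCompact (F '' Q) (hQ.image F.continuous)
  refine ⟨r, fun x => ?_⟩
  obtain ⟨g, hg⟩ := hk.exists_deck_eq_zero x
  have h1 := hr (F (g.1 x)) ⟨_, hkQ _ (by simp [hg]), rfl⟩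
  have h2 : deckVec e g = -k x := by
    rw [hk.map_deck] at hg
    exact eq_neg_of_add_eq_zero_left hg
  rw [hF.apply_deck, hk.map_deck, ← latticeAut_deckVec, h2, map_neg] at h1
  rwa [sub_eq_neg_add]

end Lift

section Contraction

variable [MetricSpace X] [CompactSpace X] [LocallyConnectedSpace X] [TopologicalSpace M]
  {f : X ≃ₜ X} {L : LocalProductStructure X} {lam C : ℝ} {D : DirectProductStructure M}
  {π : M → X} {d : ℕ} {e : deckGroup D π ≃* Multiplicative (Fin d → ℤ)} {k : M → Fin d → ℤ}
  {F : M ≃ₜ M}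

theorem SmaleMetric.exists_coarse_close (hf : SmaleMetric f L lam C) (hπ : IsSplitting f L D π)
    (hk : IsCoarseCoord e k) :
    ∃ ε > 0, ∃ r : ℝ, ∀ q q', D.br q q' = q →
      (∀ n : ℕ, dist ((f ^ n) (π q)) ((f ^ n) (π q')) < ε) → ‖k q - k q'‖ ≤ r := by
  have := locallyCompactSpace_of_isLocalHomeomorph hπ.isCoveringMap.isLocalHomeomorph
  choose W hWc hW using fun p : M => exists_compact_mem_nhds p
  obtain ⟨ε, hε, t, ht⟩ := hf.exists_finset_stable_close hπ hW
  obtain ⟨r, hr⟩ := hk.bounded_of_isCompact _ (t.isCompact_biUnion fun p _ => hWc p)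
  refine ⟨ε, hε, r + r, fun q q' hqq' hclose => ?_⟩
  obtain ⟨p, hp, q₁, hq₁, H⟩ := ht (π q)
  obtain ⟨g, rfl⟩ := hf.exists_deck hπ hq₁
  have h1 := H (g.1 q) (D.br_same _) fun n => by simpa using hε
  have h2 := H (g.1 q') (by rw [← g.2.1, hqq']) fun n => by
    rw [g.2.2, g.2.2]
    exact hclose n
  rw [← hk.map_deck_sub g]
  exact (norm_sub_le _ _).trans (add_le_add (hr _ (mem_biUnion hp h1)) (hr _ (mem_biUnion hp h2)))

/-- Uniform contraction of the first plaques: pairs of points at bounded coarse distance in a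
common first plaque become close after a bounded time. -/
theorem SmaleMetric.exists_uniform_contraction (hf : SmaleMetric f L lam C)
    (hπ : IsSplitting f L D π) (hk : IsCoarseCoord e k) (hF : IsLift f D π F) (r : ℝ) {ε : ℝ}
    (hε : 0 < ε) :
    ∃ n₀ : ℕ, ∀ x y, D.br x y = x → ‖k x - k y‖ ≤ r → ∀ n ≥ n₀,
      dist ((f ^ n) (π x)) ((f ^ n) (π y)) ≤ ε := by
  have := t2Space_of_isCoveringMap hπ.isCoveringMap
  choose O hO HO using hf.exists_nhds_contracting hπ
  obtain ⟨ε₁, hε₁, t, ht⟩ := hf.exists_finset_stable_close hπ fun p => interior_mem_nhds.2 (hO p)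
  have hlim : Tendsto (fun n : ℕ => C * lam ^ n * Metric.diam (univ : Set X)) atTop (𝓝 0) := by
    simpa using ((tendsto_pow_atTop_nhds_zero_of_lt_one hf.lam_pos.le hf.lam_lt_one).const_mul
      C).mul_const (Metric.diam (univ : Set X))
  obtain ⟨n₁, hn₁⟩ := eventually_atTop.1 (hlim.eventually_lt_const hε)
  obtain ⟨Q, hQ, hkQ⟩ := hk.exists_isCompact 0
  obtain ⟨Q', hQ', hkQ'⟩ := hk.exists_isCompact r
  have key : ∃ n₀ : ℕ, ∀ z ∈ Q ×ˢ Q', D.br z.1 z.2 = z.1 → ∀ n ≥ n₀,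
      dist ((f ^ n) (π z.1)) ((f ^ n) (π z.2)) ≤ ε := by
    refine (hQ.prod hQ').induction_on (p := fun S => ∃ n₀ : ℕ, ∀ z ∈ S, D.br z.1 z.2 = z.1 →
      ∀ n ≥ n₀, dist ((f ^ n) (π z.1)) ((f ^ n) (π z.2)) ≤ ε) ?_ ?_ ?_ ?_
    · exact ⟨0, by simp⟩
    · rintro s t hst ⟨n, hn⟩
      exact ⟨n, fun z hz => hn z (hst hz)⟩
    · rintro s t ⟨n, hn⟩ ⟨m, hm⟩
      refine ⟨max n m, ?_⟩
      rintro z (hz | hz) hbr i hi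
      exacts [hn z hz hbr i (le_of_max_le_left hi), hm z hz hbr i (le_of_max_le_right hi)]
    rintro ⟨x, y⟩ -
    by_cases hxy : D.br x y = x
    · obtain ⟨m, hm⟩ := (hπ.stablyEquivalent hxy).exists_dist_lt hε₁
      have hFm := hF.pow m
      obtain ⟨p, -, q₁, hq₁, H⟩ := ht ((f ^ m) (π x))
      rw [← hFm.semiconj] at hq₁
      obtain ⟨g, rfl⟩ := hf.exists_deck hπ hq₁
      have h1 := H _ (D.br_same _) fun n => by simpa using hε₁
      have h2 := H (g.1 ((F ^ m) y)) (by rw [← g.2.1, ← hFm.map_br, hxy]) fun n => by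
        rw [g.2.2, g.2.2, hFm.semiconj, hFm.semiconj]
        exact hm n
      have hcont := g.1.continuous.comp (F ^ m).continuous
      refine ⟨((fun x => g.1 ((F ^ m) x)) ⁻¹' interior (O p)) ×ˢ
        ((fun x => g.1 ((F ^ m) x)) ⁻¹' interior (O p)),
        mem_nhdsWithin_of_mem_nhds (prod_mem_nhds
          ((isOpen_interior.preimage hcont).mem_nhds h1)
          ((isOpen_interior.preimage hcont).mem_nhds h2)), m + n₁, ?_⟩
      rintro ⟨x', y'⟩ ⟨hx', hy'⟩ hxy' n hn
      obtain ⟨i, rfl⟩ : ∃ i, n = i + m := ⟨n - m, by omega⟩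
      have h3 := HO p _ (interior_subset hx') _ (interior_subset hy')
        (by rw [← g.2.1, ← hFm.map_br, hxy']) i
      simp only [g.2.2, hFm.semiconj] at h3
      rw [pow_add]
      refine (h3.trans (mul_le_mul_of_nonneg_left ?_ ?_)).trans (hn₁ i (by omega)).le
      · exact Metric.dist_le_diam_of_mem isCompact_univ.isBounded (mem_univ _) (mem_univ _)
      · exact mul_nonneg hf.C_pos.le (pow_nonneg hf.lam_pos.le i)
    · refine ⟨{z | D.br z.1 z.2 ≠ z.1}, mem_nhdsWithin_of_mem_nhds
        ((isOpen_ne_fun D.continuous_br continuous_fst).mem_nhds hxy), 0, ?_⟩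
      exact fun z hz h => absurd h hz
  obtain ⟨n₀, hn₀⟩ := key
  refine ⟨n₀, fun x y hxy hkxy n hn => ?_⟩
  obtain ⟨g, hg⟩ := hk.exists_deck_eq_zero x
  rw [← hk.map_deck_sub g, hg, zero_sub, norm_neg] at hkxy
  have := hn₀ (g.1 x, g.1 y) ⟨hkQ _ (by simp [hg]), hkQ' _ hkxy⟩ (by simp only [← g.2.1, hxy]) n hn
  simpa only [g.2.2] using this

theorem SmaleMetric.exists_coarse_contraction (hf : SmaleMetric f L lam C)
    (hπ : IsSplitting f L D π) (hk : IsCoarseCoord e k) (hF : IsLift f D π F) :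
    ∃ r₀ : ℝ, ∀ r : ℝ, ∃ n₀ : ℕ, ∀ x y, D.br x y = x → ‖k x - k y‖ ≤ r → ∀ n ≥ n₀,
      ‖k ((F ^ n) x) - k ((F ^ n) y)‖ ≤ r₀ := by
  obtain ⟨ε, hε, r₀, H⟩ := hf.exists_coarse_close hπ hk
  refine ⟨r₀, fun r => ?_⟩
  obtain ⟨n₀, hn₀⟩ := hf.exists_uniform_contraction hπ hk hF r (half_pos hε)
  refine ⟨n₀, fun x y hxy hkxy n hn => H _ _ ?_ fun i => ?_⟩
  · rw [← (hF.pow n).map_br, hxy]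
  · rw [(hF.pow n).semiconj, (hF.pow n).semiconj]
    have := hn₀ x y hxy hkxy (i + n) (by omega)
    rw [pow_add] at this
    exact this.trans_lt (half_lt_self hε)

theorem SmaleMetric.br_eq_right_of_coarse_bounded (hf : SmaleMetric f L lam C)
    (hπ : IsSplitting f L D π) (hk : IsCoarseCoord e k) (hF : IsLift f D π F) {r : ℝ} {x y : M}
    (h : ∀ n : ℤ, ‖k ((F ^ n) x) - k ((F ^ n) y)‖ ≤ r) : D.br x y = y := by
  obtain ⟨r', hr'⟩ := hk.swap.exists_br_bound r
  have hz : ∀ n : ℤ, ‖k ((F ^ n) (D.br x y)) - k ((F ^ n) y)‖ ≤ r' := fun n => by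
    rw [(hF.zpow n).map_br, norm_sub_rev]
    exact hr' _ _ (by rw [norm_sub_rev]; exact h n)
  refine hπ.eq_of_plaque₁ (p := D.br x y) (D.br_same _) (by simp) ?_
  refine eq_of_forall_dist_le fun ε hε => ?_
  obtain ⟨n, hn⟩ := hf.exists_uniform_contraction hπ hk hF r' hε
  have := hn _ _ (by rw [← (hF.zpow _).map_br]; simp) (hz (-n)) n le_rfl
  have hcancel : ∀ z, (f ^ n) ((f ^ (-(n : ℤ))) z) = z := fun z => by
    change (f ^ n * f ^ (-(n : ℤ))) z = z
    simp
  rwa [(hF.zpow _).semiconj, (hF.zpow _).semiconj, hcancel, hcancel] at this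

/-- Coarse expansivity: two points of `M` whose orbits under a lift stay at bounded distance for
all times, past and future, are equal. -/
theorem SmaleMetric.eq_of_coarse_bounded (hf : SmaleMetric f L lam C) (hπ : IsSplitting f L D π)
    (hk : IsCoarseCoord e k) (hF : IsLift f D π F) {r : ℝ} {x y : M}
    (h : ∀ n : ℤ, ‖k ((F ^ n) x) - k ((F ^ n) y)‖ ≤ r) : x = y := by
  have h1 := hf.br_eq_right_of_coarse_bounded hπ hk hF h
  have h2 := hf.swap.br_eq_right_of_coarse_bounded hπ.swap hk.swap hF.swap (r := r) (x := x)
    (y := y) fun n => by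
      rw [inv_zpow']
      exact h (-n)
  exact (D.br_eq_right_comm.1 h2).symm.trans h1

end Contraction

/-! ### Integral vectors -/

section Lattice

variable {d : ℕ}

/-- The inclusion of `ℤᵈ` into `ℝᵈ`. -/
def toReal (v : Fin d → ℤ) : Fin d → ℝ := fun i => v i

theorem toReal_add (v w : Fin d → ℤ) : toReal (v + w) = toReal v + toReal w := by
  ext i
  simp [toReal]

theorem toReal_sub (v w : Fin d → ℤ) : toReal (v - w) = toReal v - toReal w := by
  ext i
  simp [toReal]

theorem norm_toReal (v : Fin d → ℤ) : ‖toReal v‖ = ‖v‖ := by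
  apply le_antisymm
  · refine (pi_norm_le_iff_of_nonneg (norm_nonneg _)).2 fun i => ?_
    simpa [toReal, Int.norm_eq_abs] using norm_le_pi_norm v i
  · refine (pi_norm_le_iff_of_nonneg (norm_nonneg _)).2 fun i => ?_
    simpa [toReal, Int.norm_eq_abs] using norm_le_pi_norm (toReal v) i

theorem exists_norm_toReal_sub_le (y : Fin d → ℝ) : ∃ v : Fin d → ℤ, ‖toReal v - y‖ ≤ 1 := by
  refine ⟨fun i => round (y i), (pi_norm_le_iff_of_nonneg zero_le_one).2 fun i => ?_⟩
  simp only [toReal, Pi.sub_apply, Real.norm_eq_abs]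
  rw [abs_sub_comm]
  exact (abs_sub_round (y i)).trans (by norm_num)

theorem finite_norm_le (r : ℝ) : {v : Fin d → ℤ | ‖v‖ ≤ r}.Finite := by
  have := (isCompact_closedBall (0 : Fin d → ℤ) r).finite_of_discrete
  refine this.subset fun v hv => ?_
  rwa [mem_closedBall_zero_iff]

end Lattice

/-! ### A growth criterion for hyperbolicity -/

theorem exists_pow_near_one {μ : ℂ} (hμ : ‖μ‖ = 1) {ε : ℝ} (hε : 0 < ε) (N : ℕ) :
    ∃ j ≥ N, ‖1 - μ ^ j‖ ≤ ε := by
  have hmem : ∀ n : ℕ, μ ^ n ∈ Metric.closedBall (0 : ℂ) 1 := fun n => by simp [hμ]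
  obtain ⟨a, -, φ, hφ, hlim⟩ := (isCompact_closedBall (0 : ℂ) 1).tendsto_subseq hmem
  obtain ⟨n, hn⟩ := Metric.cauchySeq_iff'.1 hlim.cauchySeq ε hε
  have h1 : φ n + N ≤ φ (n + N) := by
    clear hn
    induction N with
    | zero => simp
    | succ N ih => exact Nat.succ_le_of_lt (lt_of_le_of_lt ih (hφ (Nat.lt_succ_self _)))
  refine ⟨φ (n + N) - φ n, by omega, ?_⟩
  have h2 := hn (n + N) (by omega)
  have h3 : μ ^ φ (n + N) = μ ^ φ n * μ ^ (φ (n + N) - φ n) := by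
    rw [← pow_add]
    congr 1
    omega
  simp only [Function.comp, dist_eq_norm] at h2
  rw [h3, ← mul_sub_one, norm_mul, norm_pow, hμ, one_pow, one_mul, norm_sub_rev] at h2
  exact h2.le

section Growth

variable {d : ℕ}

/-- Let `B r v` be a notion of "the vector `v` has size at most `r`" for which an automorphism `β`
of `ℤᵈ` is contracting after a bounded time. If `β` has an invariant family `w c`, `c ∈ ℂ`, of
real vectors on which it acts as a rotation, then along this family the size grows slower than any
power: a vector `v` close to `w c` differs from `β ^ j v` by a vector close to the much shorter
`w ((1 - μ ^ j) c)`, while the time needed to contract `v` to bounded size behaves like the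
logarithm of an ultrametric norm. -/
theorem exists_bound_along_rotation (β : (Fin d → ℤ) ≃+ (Fin d → ℤ))
    (B : ℝ → (Fin d → ℤ) → Prop) (hmono : ∀ r r' v, B r v → r ≤ r' → B r' v)
    (hadd : ∀ r r' v v', B r v → B r' v' → B (r + r') (v + v')) (hfin : ∀ v, ∃ r, B r v)
    {a b : ℝ} (ha : 0 ≤ a) (hb : 0 ≤ b) (hgrow : ∀ r v, B r (β v) → B (a * r + b) v)
    {r₀ : ℝ} (hcontr : ∀ r, ∃ n₀, ∀ v, B r v → ∀ n ≥ n₀, B r₀ (β^[n] v))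
    {μ : ℂ} (hμ : ‖μ‖ = 1) (w : ℂ →ₗ[ℝ] (Fin d → ℝ)) {s : ℝ} (hs : 0 ≤ s)
    (hw : ∀ v c, ‖toReal (β v) - w (μ * c)‖ ≤ s * ‖toReal v - w c‖) :
    ∃ Γ ≥ (1 : ℝ), ∀ ε : ℝ, 0 < ε → ε < 1 → ∃ K : ℝ, ∀ q : ℕ, ∀ c : ℂ, ‖c‖ ≤ (ε⁻¹) ^ q →
      ∀ v, ‖toReal v - w c‖ ≤ 1 → B (K * Γ ^ q) v := by
  classical
  -- `τ v n`: the vector `v` is contracted to bounded size after time `n`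
  let τ : (Fin d → ℤ) → ℕ → Prop := fun v n => ∀ i ≥ n, B r₀ (β^[i] v)
  have hτmono : ∀ v n m, τ v n → n ≤ m → τ v m := fun v n m h hnm i hi => h i (hnm.trans hi)
  have hτfin : ∀ v, ∃ n, τ v n := fun v => by
    obtain ⟨r, hr⟩ := hfin v
    obtain ⟨n, hn⟩ := hcontr r
    exact ⟨n, hn v hr⟩
  obtain ⟨k, hk⟩ := hcontr (r₀ + r₀)
  have hβadd : ∀ n v v', β^[n] (v + v') = β^[n] v + β^[n] v' := fun n v v' =>
    iterate_map_add β n v v'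
  have hτadd : ∀ v v' n, τ v n → τ v' n → τ (v + v') (n + k) := by
    intro v v' n h h' i hi
    have := hk _ (hadd _ _ _ _ (h n le_rfl) (h' n le_rfl)) (i - n) (by omega)
    rwa [← hβadd, ← Function.iterate_add_apply, Nat.sub_add_cancel (by omega)] at this
  have hτshift : ∀ v n j, τ v n → τ (β^[j] v) (n - j) := by
    intro v n j h i hi
    rw [← Function.iterate_add_apply]
    exact h _ (by omega)
  have hτball : ∀ r : ℝ, ∃ n, ∀ v : Fin d → ℤ, ‖v‖ ≤ r → τ v n := by
    intro r
    choose n hn using hτfin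
    obtain ⟨m, hm⟩ := ((finite_norm_le (d := d) r).image n).bddAbove
    exact ⟨m, fun v hv => hτmono v _ _ (hn v) (hm ⟨v, hv, rfl⟩)⟩
  have hgrowth : ∃ G ≥ (1 : ℝ), ∃ K, ∀ n v, τ v n → B (K * G ^ n) v := by
    refine ⟨a + b + 1, by linarith, max r₀ 1, fun n v h => ?_⟩
    have h0 : B (max r₀ 1) (β^[n] v) := hmono _ _ _ (h n le_rfl) (le_max_left _ _)
    clear h
    induction n generalizing v with
    | zero => simpa using h0
    | succ n ih =>
      rw [Function.iterate_succ_apply] at h0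
      refine hmono _ _ _ (hgrow _ _ (ih _ h0)) ?_
      have h1 : 1 ≤ max r₀ 1 * (a + b + 1) ^ n :=
        one_le_mul_of_one_le_of_one_le (le_max_right _ _) (one_le_pow₀ (by linarith))
      rw [pow_succ]
      nlinarith
  obtain ⟨G, hG, K, hK⟩ := hgrowth
  obtain ⟨κ, hκ⟩ : ∃ κ : ℝ, ∀ c, ‖w c‖ ≤ κ * ‖c‖ :=
    ⟨_, fun c => (LinearMap.toContinuousLinearMap w).le_opNorm c⟩
  -- `Q t n`: all vectors near the disc of radius `t` are contracted after time `n`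
  let Q : ℝ → ℕ → Prop := fun t n => ∀ c : ℂ, ‖c‖ ≤ t → ∀ v, ‖toReal v - w c‖ ≤ 1 → τ v n
  have hQfin : ∀ t, ∃ n, Q t n := by
    intro t
    obtain ⟨n, hn⟩ := hτball (|κ| * t + 1)
    refine ⟨n, fun c hc v hv => hn v ?_⟩
    have h1 : ‖w c‖ ≤ |κ| * t := (hκ c).trans (mul_le_mul (le_abs_self κ) hc (norm_nonneg c)
      (abs_nonneg κ))
    rw [← norm_toReal]
    linarith [norm_sub_norm_le (toReal v) (w c)]
  have hwiter : ∀ j v c, ‖toReal (β^[j] v) - w (μ ^ j * c)‖ ≤ s ^ j * ‖toReal v - w c‖ := by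
    intro j
    induction j with
    | zero => simp
    | succ j ih =>
      intro v c
      rw [Function.iterate_succ_apply', pow_succ', mul_assoc, pow_succ' s, mul_assoc]
      exact (hw _ _).trans (mul_le_mul_of_nonneg_left (ih v c) hs)
  refine ⟨G ^ (2 * k), one_le_pow₀ hG, fun ε hε hε1 => ?_⟩
  obtain ⟨j, hj, hjε⟩ := exists_pow_near_one hμ hε (k + 1)
  obtain ⟨m, hm⟩ := hτball (2 + s ^ j)
  -- enlarging the disc by a factor `ε⁻¹` costs only a constant time `2 * k`
  have hstep : ∀ t n, m ≤ n → Q (ε * t) n → Q t (n + 2 * k) := by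
    intro t n hmn hQ
    obtain ⟨n', hn'⟩ := hQfin t
    -- any larger time can be lowered by one: `v` is the sum of `β ^ j v`, which needs `j > k` steps
    -- less than `v`, of a vector `u` near the smaller disc, and of a bounded vector
    have hdesc : ∀ i, Q t (n + 2 * k + i) → Q t (n + 2 * k) := by
      intro i
      induction i with
      | zero => exact id
      | succ i ih =>
        intro hi
        refine ih fun c hc v hv => ?_
        have h1 := hτshift v _ j (hi c hc v hv)
        obtain ⟨u, hu⟩ := exists_norm_toReal_sub_le (w ((1 - μ ^ j) * c))
        have h2 : τ u n := by
          refine hQ _ ?_ u hu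
          rw [norm_mul]
          exact mul_le_mul hjε hc (norm_nonneg c) hε.le
        have h3 : τ (v - β^[j] v - u) n := by
          refine hτmono _ _ _ (hm _ ?_) hmn
          have h4 := hwiter j v c
          have h5 : s ^ j * ‖toReal v - w c‖ ≤ s ^ j :=
            mul_le_of_le_one_right (pow_nonneg hs j) hv
          have h6 : toReal (v - β^[j] v - u) = (toReal v - w c) -
              (toReal (β^[j] v) - w (μ ^ j * c)) - (toReal u - w ((1 - μ ^ j) * c)) := by
            rw [toReal_sub, toReal_sub, sub_mul, one_mul, map_sub]
            abel
          rw [← norm_toReal, h6]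
          have h7 := norm_sub_le ((toReal v - w c) - (toReal (β^[j] v) - w (μ ^ j * c)))
            (toReal u - w ((1 - μ ^ j) * c))
          have h8 := norm_sub_le (toReal v - w c) (toReal (β^[j] v) - w (μ ^ j * c))
          linarith
        have h4 := hτadd _ _ _ h2 h3
        have h5 := hτadd _ _ (n + k + i) (hτmono _ _ _ h1 (by omega)) (hτmono _ _ _ h4 (by omega))
        rw [show β^[j] v + (u + (v - β^[j] v - u)) = v by abel] at h5
        exact hτmono _ _ _ h5 (by omega)
    exact hdesc n' fun c hc v hv => hτmono _ _ _ (hn' c hc v hv) (by omega)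
  obtain ⟨m₁, hm₁⟩ := hQfin 1
  have hall : ∀ q : ℕ, Q (ε⁻¹ ^ q) (max m m₁ + 2 * k * q) := by
    intro q
    induction q with
    | zero =>
      intro c hc v hv
      exact hτmono _ _ _ (hm₁ c (by simpa using hc) v hv) (by simp)
    | succ q ih =>
      have h1 : ε * ε⁻¹ ^ (q + 1) = ε⁻¹ ^ q := by
        rw [pow_succ']
        field_simp
      have := hstep (ε⁻¹ ^ (q + 1)) _ ((le_max_left m m₁).trans (Nat.le_add_right _ _))
        (by rwa [h1])
      rwa [add_assoc, ← mul_add_one] at this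
  refine ⟨K * G ^ max m m₁, fun q c hc v hv => ?_⟩
  have := hK _ _ (hall q c hc v hv)
  rwa [pow_add, pow_mul, ← mul_assoc] at this

end Growth

/-! ### Real extensions of integral automorphisms -/

section RealExtension

variable {d : ℕ}

/-- The matrix of an automorphism of `ℤᵈ`. -/
def intMatrix (β : (Fin d → ℤ) ≃+ (Fin d → ℤ)) : Matrix (Fin d) (Fin d) ℤ :=
  LinearMap.toMatrix' β.toAddMonoidHom.toIntLinearMap

theorem intMatrix_mulVec (β : (Fin d → ℤ) ≃+ (Fin d → ℤ)) (v : Fin d → ℤ) :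
    (intMatrix β).mulVec v = β v :=
  LinearMap.toMatrix'_mulVec _ _

theorem intMatrix_mul_symm (β : (Fin d → ℤ) ≃+ (Fin d → ℤ)) :
    intMatrix β * intMatrix β.symm = 1 := by
  refine Matrix.ext_of_mulVec_single fun i => ?_
  rw [← Matrix.mulVec_mulVec, intMatrix_mulVec, intMatrix_mulVec, β.apply_symm_apply,
    Matrix.one_mulVec]

theorem intMatrix_symm_mul (β : (Fin d → ℤ) ≃+ (Fin d → ℤ)) :
    intMatrix β.symm * intMatrix β = 1 :=
  intMatrix_mul_symm β.symm

theorem map_mulVec_toReal (A : Matrix (Fin d) (Fin d) ℤ) (v : Fin d → ℤ) :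
    (A.map (Int.cast : ℤ → ℝ)).mulVec (toReal v) = toReal (A.mulVec v) := by
  ext i
  simp [toReal, Matrix.mulVec, dotProduct]

theorem map_mul_map_eq_one {A B : Matrix (Fin d) (Fin d) ℤ} (h : A * B = 1) :
    A.map (Int.cast : ℤ → ℝ) * B.map (Int.cast : ℤ → ℝ) = 1 := by
  have : A.map (Int.castRingHom ℝ) * B.map (Int.castRingHom ℝ) = 1 := by
    rw [← Matrix.map_mul, h]
    exact Matrix.map_one _ (map_zero _) (map_one _)
  exact this

/-- The real linear extension of an automorphism of `ℤᵈ`. -/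
def realAut (β : (Fin d → ℤ) ≃+ (Fin d → ℤ)) : (Fin d → ℝ) ≃ₗ[ℝ] (Fin d → ℝ) :=
  LinearEquiv.ofLinearMap (Matrix.toLin' ((intMatrix β).map (Int.cast : ℤ → ℝ)))
    (Matrix.toLin' ((intMatrix β.symm).map (Int.cast : ℤ → ℝ)))
    (by rw [← Matrix.toLin'_mul, map_mul_map_eq_one (intMatrix_mul_symm β), Matrix.toLin'_one])
    (by rw [← Matrix.toLin'_mul, map_mul_map_eq_one (intMatrix_symm_mul β), Matrix.toLin'_one])

theorem realAut_apply (β : (Fin d → ℤ) ≃+ (Fin d → ℤ)) (y : Fin d → ℝ) :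
    realAut β y = ((intMatrix β).map (Int.cast : ℤ → ℝ)).mulVec y :=
  rfl

theorem realAut_toReal (β : (Fin d → ℤ) ≃+ (Fin d → ℤ)) (v : Fin d → ℤ) :
    realAut β (toReal v) = toReal (β v) := by
  rw [realAut_apply, map_mulVec_toReal, intMatrix_mulVec]

theorem realAut_symm (β : (Fin d → ℤ) ≃+ (Fin d → ℤ)) : (realAut β).symm = realAut β.symm :=
  rfl

theorem exists_norm_realAut_le (β : (Fin d → ℤ) ≃+ (Fin d → ℤ)) :
    ∃ s : ℝ, 0 ≤ s ∧ ∀ y, ‖realAut β y‖ ≤ s * ‖y‖ :=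
  ⟨_, norm_nonneg _, fun y =>
    (LinearMap.toContinuousLinearMap (realAut β).toLinearMap).le_opNorm y⟩

theorem exists_norm_aut_le (β : (Fin d → ℤ) ≃+ (Fin d → ℤ)) :
    ∃ s : ℝ, 0 ≤ s ∧ ∀ v, ‖β v‖ ≤ s * ‖v‖ := by
  obtain ⟨s, hs, H⟩ := exists_norm_realAut_le β
  refine ⟨s, hs, fun v => ?_⟩
  rw [← norm_toReal, ← norm_toReal v, ← realAut_toReal]
  exact H _

end RealExtension

/-! ### Hyperbolicity -/

section Displacement

variable [TopologicalSpace M] {D : DirectProductStructure M} {π : M → X} {d : ℕ}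

/-- The deck transformation that corresponds to `v`, acting on the first factor of `M` only,
displaces all points of `M` by at most `r` in the coarse coordinate. -/
def DisplacementLE (e : deckGroup D π ≃* Multiplicative (Fin d → ℤ)) (k : M → Fin d → ℤ) (r : ℝ)
    (v : Fin d → ℤ) : Prop :=
  ∀ g : deckGroup D π, deckVec e g = v → ∀ x, ‖k x - k (D.br (g.1 x) x)‖ ≤ r

variable {e : deckGroup D π ≃* Multiplicative (Fin d → ℤ)} {k : M → Fin d → ℤ}

theorem DisplacementLE.mono {r r' : ℝ} {v : Fin d → ℤ} (h : DisplacementLE e k r v)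
    (hr : r ≤ r') : DisplacementLE e k r' v :=
  fun g hg x => (h g hg x).trans hr

theorem DisplacementLE.add {r r' : ℝ} {v v' : Fin d → ℤ} (h : DisplacementLE e k r v)
    (h' : DisplacementLE e k r' v') : DisplacementLE e k (r + r') (v + v') := by
  intro g hg x
  obtain ⟨g₁, rfl⟩ := deckVec_surjective e v
  obtain ⟨g₂, rfl⟩ := deckVec_surjective e v'
  rw [← deckVec_mul] at hg
  obtain rfl := deckVec_injective e hg
  have h2 := h' g₂ rfl x
  have h1 := h g₁ rfl (D.br (g₂.1 x) x)
  rw [g₁.2.1, D.br_br_left, D.br_br_right] at h1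
  have := norm_add_le _ _ |>.trans (add_le_add h1 h2)
  rw [sub_add_sub_comm, add_comm (k _) (k x), add_sub_add_right_eq_sub] at this
  exact this

/-- The action of a deck transformation on the first factor alone commutes with the deck
transformations, because their group is commutative. So its displacement function is bounded. -/
theorem IsCoarseCoord.exists_displacementLE (hk : IsCoarseCoord e k) (v : Fin d → ℤ) :
    ∃ r, DisplacementLE e k r v := by
  obtain ⟨h, rfl⟩ := deckVec_surjective e v
  obtain ⟨Q, hQ, hkQ⟩ := hk.exists_isCompact 0
  obtain ⟨r, hr⟩ := hk.bounded_of_isCompact ((fun x => D.br (h.1 x) x) '' Q)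
    (hQ.image (D.continuous_br.comp (h.1.continuous.prodMk continuous_id)))
  refine ⟨r, fun g hg x => ?_⟩
  obtain rfl := deckVec_injective e hg
  obtain ⟨u, hu⟩ := hk.exists_deck_eq_zero x
  have hcomm : u * g = g * u := deckVec_injective e (by rw [deckVec_mul, deckVec_mul, add_comm])
  have hug : u.1 (g.1 x) = g.1 (u.1 x) := congrArg (fun t : deckGroup D π => t.1 x) hcomm
  rw [← hk.map_deck_sub u, hu, zero_sub, norm_neg, u.2.1, hug]
  exact hr _ ⟨_, hkQ _ (by simp [hu]), rfl⟩

/-- Going back by one step of the induced automorphism, displacements grow at most linearly. -/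
theorem IsCoarseCoord.exists_displacement_growth [TopologicalSpace X] (hk : IsCoarseCoord e k)
    {f : X ≃ₜ X} {F : M ≃ₜ M} (hF : IsLift f D π F) : ∃ a ≥ (0 : ℝ), ∃ b ≥ (0 : ℝ), ∀ r v,
      DisplacementLE e k r (latticeAut e (inducedAut hF) v) → DisplacementLE e k (a * r + b) v := by
  obtain ⟨c, hc⟩ := hk.swap.exists_lift_bound hF.swap
  obtain ⟨a, ha, Ha⟩ := exists_norm_aut_le (latticeAut (swapEquiv e) (inducedAut hF.swap))
  refine ⟨a, ha, 2 * |c|, by positivity, fun r v hv => ?_⟩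
  intro g hg x
  subst hg
  rw [latticeAut_deckVec] at hv
  have h1 := hv _ rfl (F x)
  rw [← hF.apply_deck, ← hF.map_br] at h1
  have hback : ∀ y, ‖k y - latticeAut (swapEquiv e) (inducedAut hF.swap) (k (F y))‖ ≤ |c| := by
    intro y
    have := hc (F y)
    have hy : (F⁻¹ : M ≃ₜ M) (F y) = y := F.symm_apply_apply y
    rw [hy] at this
    exact this.trans (le_abs_self c)
  have h2 := hback x
  have h3 := hback (D.br (g.1 x) x)
  have h4 := (Ha _).trans (mul_le_mul_of_nonneg_left h1 ha)
  rw [map_sub] at h4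
  have h5 := norm_add_le (k x - latticeAut (swapEquiv e) (inducedAut hF.swap) (k (F x)))
    (latticeAut (swapEquiv e) (inducedAut hF.swap) (k (F x)) -
      latticeAut (swapEquiv e) (inducedAut hF.swap) (k (F (D.br (g.1 x) x))))
  have h6 := norm_sub_le (k x - latticeAut (swapEquiv e) (inducedAut hF.swap) (k (F x)) +
    (latticeAut (swapEquiv e) (inducedAut hF.swap) (k (F x)) -
      latticeAut (swapEquiv e) (inducedAut hF.swap) (k (F (D.br (g.1 x) x)))))
    (k (D.br (g.1 x) x) -
      latticeAut (swapEquiv e) (inducedAut hF.swap) (k (F (D.br (g.1 x) x))))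
  have h7 : k x - latticeAut (swapEquiv e) (inducedAut hF.swap) (k (F x)) +
    (latticeAut (swapEquiv e) (inducedAut hF.swap) (k (F x)) -
      latticeAut (swapEquiv e) (inducedAut hF.swap) (k (F (D.br (g.1 x) x)))) -
    (k (D.br (g.1 x) x) -
      latticeAut (swapEquiv e) (inducedAut hF.swap) (k (F (D.br (g.1 x) x)))) =
    k x - k (D.br (g.1 x) x) := by abel
  rw [h7] at h6
  linarith

/-- A deck transformation is composed of its actions on the two factors. -/
theorem IsCoarseCoord.norm_le_of_displacementLE [Nonempty M] (hk : IsCoarseCoord e k) {r r' : ℝ}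
    {v : Fin d → ℤ} (h : DisplacementLE e k r v) (h' : DisplacementLE (swapEquiv e) k r' v) :
    ‖v‖ ≤ r + r' := by
  obtain ⟨x⟩ := ‹Nonempty M›
  obtain ⟨g, rfl⟩ := deckVec_surjective e v
  have h1 := h' ⟨g.1, (deckGroup_swap D π).symm ▸ g.2⟩ rfl x
  change ‖k x - k (D.br x (g.1 x))‖ ≤ r' at h1
  have h2 := h g rfl (D.br x (g.1 x))
  rw [g.2.1, D.br_br_left, D.br_br_right, D.br_same, hk.map_deck] at h2
  have h3 := norm_add_le _ _ |>.trans (add_le_add h2 h1)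
  have h4 : k (D.br x (g.1 x)) - (deckVec e g + k x) + (k x - k (D.br x (g.1 x))) =
    -deckVec e g := by abel
  rwa [h4, norm_neg] at h3

end Displacement

section Hyperbolic

variable [MetricSpace X] [CompactSpace X] [LocallyConnectedSpace X] [TopologicalSpace M]
  {f : X ≃ₜ X} {L : LocalProductStructure X} {lam C : ℝ} {D : DirectProductStructure M}
  {π : M → X} {d : ℕ} {e : deckGroup D π ≃* Multiplicative (Fin d → ℤ)} {k : M → Fin d → ℤ}
  {F : M ≃ₜ M}

/-- The contraction of the first plaques, in terms of displacements: `x` and `[g x, x]` lie in a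
common first plaque, and `Fⁿ` maps them to `y` and `[g' y, y]`, where `y = Fⁿ x` and `g'` is the
image of `g` under the `n`-th power of the induced automorphism. -/
theorem SmaleMetric.exists_displacement_contraction (hf : SmaleMetric f L lam C)
    (hπ : IsSplitting f L D π) (hk : IsCoarseCoord e k) (hF : IsLift f D π F) :
    ∃ r₀ : ℝ, ∀ r : ℝ, ∃ n₀ : ℕ, ∀ v, DisplacementLE e k r v → ∀ n ≥ n₀,
      DisplacementLE e k r₀ ((latticeAut e (inducedAut hF))^[n] v) := by
  obtain ⟨r₀, H⟩ := hf.exists_coarse_contraction hπ hk hF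
  refine ⟨r₀, fun r => ?_⟩
  obtain ⟨n₀, hn₀⟩ := H r
  refine ⟨n₀, fun v hv n hn => ?_⟩
  obtain ⟨h, rfl⟩ := deckVec_surjective e v
  intro g hg x
  have hiter : ∀ n : ℕ, (latticeAut e (inducedAut hF))^[n] (deckVec e h) =
      deckVec e ((inducedAut hF)^[n] h) ∧
      ∀ y, ((inducedAut hF)^[n] h).1 ((F ^ n) y) = (F ^ n) (h.1 y) := by
    intro n
    induction n with
    | zero => exact ⟨rfl, fun y => rfl⟩
    | succ n ih =>
      rw [Function.iterate_succ_apply', Function.iterate_succ_apply', ih.1, latticeAut_deckVec]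
      refine ⟨rfl, fun y => ?_⟩
      rw [pow_succ']
      change (inducedAut hF _).1 (F ((F ^ n) y)) = F ((F ^ n) (h.1 y))
      rw [← hF.apply_deck, ih.2]
  rw [(hiter n).1] at hg
  obtain rfl := deckVec_injective e hg
  obtain ⟨y, rfl⟩ := (F ^ n).surjective x
  rw [(hiter n).2, ← (hF.pow n).map_br]
  exact hn₀ _ _ (by simp) (hv h rfl y) n hn

/-- The automorphism of `ℤᵈ` induced by a lift has no invariant family of real vectors on which it
acts as a rotation. -/
theorem SmaleMetric.eq_zero_of_rotation [Nonempty M] (hf : SmaleMetric f L lam C)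
    (hπ : IsSplitting f L D π) (hk : IsCoarseCoord e k) (hF : IsLift f D π F) {μ : ℂ}
    (hμ : ‖μ‖ = 1) (w : ℂ →ₗ[ℝ] (Fin d → ℝ))
    (hw : ∀ c, realAut (latticeAut e (inducedAut hF)) (w c) = w (μ * c)) : w = 0 := by
  -- displacements in the first factor; the second factor is treated by interchanging the two
  have half : ∀ {f : X ≃ₜ X} {L : LocalProductStructure X} {D : DirectProductStructure M}
      {e : deckGroup D π ≃* Multiplicative (Fin d → ℤ)} {F : M ≃ₜ M}, SmaleMetric f L lam C →
      IsSplitting f L D π → IsCoarseCoord e k → ∀ (hF : IsLift f D π F) {μ : ℂ}, ‖μ‖ = 1 →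
      (∀ c, realAut (latticeAut e (inducedAut hF)) (w c) = w (μ * c)) →
      ∃ Γ ≥ (1 : ℝ), ∀ ε : ℝ, 0 < ε → ε < 1 → ∃ K : ℝ, ∀ q : ℕ, ∀ c : ℂ, ‖c‖ ≤ (ε⁻¹) ^ q →
        ∀ v, ‖toReal v - w c‖ ≤ 1 → DisplacementLE e k (K * Γ ^ q) v := by
    intro f L D e F hf hπ hk hF μ hμ hw
    obtain ⟨r₀, hr₀⟩ := hf.exists_displacement_contraction hπ hk hF
    obtain ⟨a, ha, b, hb, hgrow⟩ := hk.exists_displacement_growth hF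
    obtain ⟨s, hs, Hs⟩ := exists_norm_realAut_le (latticeAut e (inducedAut hF))
    refine exists_bound_along_rotation (latticeAut e (inducedAut hF)) (DisplacementLE e k)
      (fun _ _ _ h h' => h.mono h') (fun _ _ _ _ h h' => h.add h') hk.exists_displacementLE
      ha hb hgrow hr₀ hμ w hs fun v c => ?_
    rw [← hw, ← realAut_toReal, ← map_sub]
    exact Hs _
  obtain ⟨Γ₁, hΓ₁, H₁⟩ := half hf hπ hk hF hμ hw
  obtain ⟨Γ₂, hΓ₂, H₂⟩ := half hf.swap hπ.swap hk.swap hF.swap (μ := μ⁻¹) (by simp [hμ]) fun c => by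
    have h1 : latticeAut (swapEquiv e) (inducedAut hF.swap) =
        (latticeAut e (inducedAut hF)).symm := AddEquiv.ext (latticeAut_swap e hF)
    have hμ0 : μ ≠ 0 := by
      rintro rfl
      simp at hμ
    rw [h1, ← realAut_symm, LinearEquiv.symm_apply_eq, hw, mul_inv_cancel_left₀ hμ0]
  by_contra hne
  obtain ⟨c₀, hc₀⟩ : ∃ c, w c ≠ 0 := by
    by_contra! h
    exact hne (LinearMap.ext h)
  set Γ := Γ₁ * Γ₂ with hΓ
  have hΓ1 : 1 ≤ Γ := one_le_mul_of_one_le_of_one_le hΓ₁ hΓ₂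
  -- the size of `v ≈ w c` is at most `Γ ^ q` as long as `‖c‖ ≤ (2 Γ) ^ q`, up to a constant
  obtain ⟨K₁, hK₁⟩ := H₁ (2 * Γ)⁻¹ (by positivity) (inv_lt_one_of_one_lt₀ (by linarith))
  obtain ⟨K₂, hK₂⟩ := H₂ (2 * Γ)⁻¹ (by positivity) (inv_lt_one_of_one_lt₀ (by linarith))
  rw [inv_inv] at hK₁ hK₂
  have hc₀0 : c₀ ≠ 0 := fun h => hc₀ (by rw [h, map_zero])
  have hbound : ∀ q : ℕ, ‖w c₀‖ / ‖c₀‖ * 2 ^ q ≤ |K₁| + |K₂| + 1 := by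
    intro q
    set c : ℂ := ((2 * Γ) ^ q / ‖c₀‖ : ℝ) * c₀ with hc
    have hcn : ‖c‖ = (2 * Γ) ^ q := by
      rw [hc, norm_mul, Complex.norm_real, Real.norm_of_nonneg (by positivity)]
      field_simp
    have hwc : ‖w c‖ = ‖w c₀‖ / ‖c₀‖ * 2 ^ q * Γ ^ q := by
      rw [hc, ← Complex.real_smul, map_smul, norm_smul, Real.norm_of_nonneg (by positivity),
        mul_pow]
      ring
    obtain ⟨v, hv⟩ := exists_norm_toReal_sub_le (w c)
    have h1 := hk.norm_le_of_displacementLE (hK₁ q c hcn.le v hv) (hK₂ q c hcn.le v hv)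
    have h2 : ‖w c‖ ≤ ‖v‖ + 1 := by
      rw [← norm_toReal]
      linarith [norm_sub_norm_le (w c) (toReal v), norm_sub_rev (w c) (toReal v)]
    have h3 : Γ₁ ^ q ≤ Γ ^ q := pow_le_pow_left₀ (by linarith) (by nlinarith) q
    have h4 : Γ₂ ^ q ≤ Γ ^ q := pow_le_pow_left₀ (by linarith) (by nlinarith) q
    have h5 : 1 ≤ Γ ^ q := one_le_pow₀ hΓ1
    have h6 : K₁ * Γ₁ ^ q ≤ |K₁| * Γ ^ q :=
      mul_le_mul (le_abs_self _) h3 (by positivity) (abs_nonneg _)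
    have h7 : K₂ * Γ₂ ^ q ≤ |K₂| * Γ ^ q :=
      mul_le_mul (le_abs_self _) h4 (by positivity) (abs_nonneg _)
    refine le_of_mul_le_mul_right ?_ (show 0 < Γ ^ q by positivity)
    rw [← hwc]
    linarith
  have hpos : 0 < ‖w c₀‖ / ‖c₀‖ := div_pos (norm_pos_iff.2 hc₀) (norm_pos_iff.2 hc₀0)
  obtain ⟨q, hq⟩ := pow_unbounded_of_one_lt ((|K₁| + |K₂| + 1) / (‖w c₀‖ / ‖c₀‖)) one_lt_two
  rw [div_lt_iff₀ hpos] at hq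
  linarith [hbound q, mul_comm (2 ^ q) (‖w c₀‖ / ‖c₀‖)]

theorem isUnit_autMatrix {G : Type*} [Group G] (e : G ≃* Multiplicative (Fin d → ℤ))
    (φ : G ≃* G) : IsUnit (autMatrix e φ) :=
  IsUnit.of_mul_eq_one _ (intMatrix_mul_symm (latticeAut e φ))

theorem SmaleMetric.isHyperbolic [Nonempty M] (hf : SmaleMetric f L lam C)
    (hπ : IsSplitting f L D π) (hk : IsCoarseCoord e k) (hF : IsLift f D π F) :
    IsHyperbolic (autMatrix e (inducedAut hF)) := by
  refine ⟨isUnit_autMatrix e _, fun μ hμ hμ1 => ?_⟩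
  set A := autMatrix e (inducedAut hF) with hA
  rw [← Matrix.spectrum_toLin', ← Module.End.hasEigenvalue_iff_mem_spectrum] at hμ
  obtain ⟨ζ, hζ, hζ0⟩ := hμ.exists_hasEigenvector
  rw [Module.End.mem_eigenspace_iff, Matrix.toLin'_apply] at hζ
  -- the real vectors `Re (c ζ)`
  let w : ℂ →ₗ[ℝ] (Fin d → ℝ) := LinearMap.pi fun i =>
    Complex.reLm ∘ₗ LinearMap.mulRight ℝ (ζ i)
  have hwapp : ∀ c i, w c i = (c * ζ i).re := fun c i => rfl
  have hw : ∀ c, realAut (latticeAut e (inducedAut hF)) (w c) = w (μ * c) := by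
    intro c
    ext i
    have h1 := congrFun hζ i
    rw [Pi.smul_apply, smul_eq_mul] at h1
    rw [hwapp, mul_comm μ c, mul_assoc, ← h1, realAut_apply]
    simp only [Matrix.mulVec, dotProduct, Matrix.map_apply, hwapp, Finset.mul_sum, Complex.re_sum]
    refine Finset.sum_congr rfl fun j _ => ?_
    rw [mul_left_comm, ← Complex.ofReal_intCast, Complex.re_ofReal_mul]
    rfl
  have hw0 := hf.eq_zero_of_rotation hπ hk hF hμ1 w hw
  refine hζ0 (funext fun i => ?_)
  have h1 := congrFun (LinearMap.congr_fun hw0 1) i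
  have h2 := congrFun (LinearMap.congr_fun hw0 Complex.I) i
  rw [hwapp] at h1 h2
  refine Complex.ext (by simpa using h1) (by simpa using h2)

end Hyperbolic

/-! ### The shadowing equation -/

section BanachAlgebra

variable {R : Type*} [Ring R] [Algebra ℂ R]

/-- Two commuting elements `U`, `A` satisfy `U - A ∣ p(U) - p(A)`. -/
theorem exists_aeval_sub_aeval {U A : R} (h : Commute U A) (p : Polynomial ℂ) :
    ∃ S : R, Commute S U ∧ Commute S A ∧
      Polynomial.aeval U p - Polynomial.aeval A p = S * (U - A) := by
  induction p using Polynomial.induction_on' with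
  | add p q hp hq =>
    obtain ⟨S, h1, h2, h3⟩ := hp
    obtain ⟨T, h4, h5, h6⟩ := hq
    refine ⟨S + T, h1.add_left h4, h2.add_left h5, ?_⟩
    rw [map_add, map_add, add_mul, ← h3, ← h6]
    abel
  | monomial n a =>
    refine ⟨a • ∑ i ∈ Finset.range n, U ^ i * A ^ (n - 1 - i), ?_, ?_, ?_⟩
    · exact (Commute.sum_left _ _ _ fun i _ =>
        (Commute.pow_left (Commute.refl U) i).mul_left (h.symm.pow_left _)).smul_left a
    · exact (Commute.sum_left _ _ _ fun i _ =>
        (h.pow_left i).mul_left (Commute.pow_left (Commute.refl A) _)).smul_left a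
    · rw [smul_mul_assoc, h.geom_sum₂_mul, Polynomial.aeval_monomial, Polynomial.aeval_monomial,
        ← mul_sub, Algebra.smul_def]

theorem isUnit_sub_of_aeval_eq_zero {U A : R} (h : Commute U A) (p : Polynomial ℂ)
    (hA : Polynomial.aeval A p = 0) (hU : IsUnit (Polynomial.aeval U p)) : IsUnit (U - A) := by
  obtain ⟨S, h1, h2, h3⟩ := exists_aeval_sub_aeval h p
  rw [hA, sub_zero] at h3
  rw [h3, (h1.sub_right h2).isUnit_mul_iff] at hU
  exact hU.2

theorem isUnit_aeval_of_forall_root {U : R} (p : Polynomial ℂ) (hp : p ≠ 0)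
    (hU : ∀ r, p.IsRoot r → r ∉ spectrum ℂ U) : IsUnit (Polynomial.aeval U p) := by
  rw [(IsAlgClosed.splits p).eq_prod_roots, map_mul, Polynomial.aeval_C]
  refine ((Polynomial.leadingCoeff_ne_zero.2 hp).isUnit.map (algebraMap ℂ R)).mul ?_
  rw [← Multiset.prod_toList, map_list_prod]
  refine List.prod_isUnit fun a ha => ?_
  obtain ⟨q, hq, rfl⟩ := List.mem_map.1 ha
  obtain ⟨r, hr, rfl⟩ := Multiset.mem_map.1 (Multiset.mem_toList.1 hq)
  have := spectrum.notMem_iff.1 (hU r (Polynomial.isRoot_of_mem_roots hr))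
  rw [map_sub, Polynomial.aeval_X, Polynomial.aeval_C]
  rw [← neg_sub, IsUnit.neg_iff]
  exact this

end BanachAlgebra

theorem norm_eq_one_of_mem_spectrum {R : Type*} [NormedRing R] [NormedAlgebra ℂ R]
    [CompleteSpace R] (h1 : ‖(1 : R)‖ ≤ 1) (U : Rˣ) (hU : ‖(U : R)‖ ≤ 1)
    (hU' : ‖((U⁻¹ : Rˣ) : R)‖ ≤ 1) {r : ℂ} (hr : r ∈ spectrum ℂ (U : R)) : ‖r‖ = 1 := by
  have key : ∀ (V : R) (s : ℂ), ‖V‖ ≤ 1 → s ∈ spectrum ℂ V → ‖s‖ ≤ 1 := fun V s hV hs => by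
    have := mem_closedBall_zero_iff.1 (spectrum.subset_closedBall_norm_mul V hs)
    exact this.trans (mul_le_one₀ hV (norm_nonneg _) h1)
  have hr0 : r ≠ 0 := by
    rintro rfl
    exact spectrum.zero_notMem ℂ U.isUnit hr
  refine le_antisymm (key _ _ hU hr) ?_
  have h2 : r⁻¹ ∈ spectrum ℂ ((U⁻¹ : Rˣ) : R) := by
    have := (spectrum.inv_mem_iff (r := Units.mk0 r hr0) (a := U)).1 hr
    simpa using this
  have h3 := key _ _ hU' h2
  rw [norm_inv] at h3
  exact (inv_le_one₀ (norm_pos_iff.2 hr0)).1 h3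

/-- If `U` has its spectrum in the unit circle and `A` has no eigenvalue there, then `U - A` is
invertible, because it divides `p(U) - p(A) = p(U)` for the characteristic polynomial `p` of `A`. -/
theorem isUnit_sub_algHom {R : Type*} [NormedRing R] [NormedAlgebra ℂ R]
    [CompleteSpace R] (h1 : ‖(1 : R)‖ ≤ 1) (U : Rˣ) (hU : ‖(U : R)‖ ≤ 1)
    (hU' : ‖((U⁻¹ : Rˣ) : R)‖ ≤ 1) {d : ℕ} (T : Matrix (Fin d) (Fin d) ℂ →ₐ[ℂ] R)
    {A : Matrix (Fin d) (Fin d) ℂ} (hA : ∀ μ ∈ spectrum ℂ A, ‖μ‖ ≠ 1)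
    (hcomm : Commute (U : R) (T A)) : IsUnit ((U : R) - T A) := by
  refine isUnit_sub_of_aeval_eq_zero hcomm A.charpoly ?_ ?_
  · rw [Polynomial.aeval_algHom_apply, Matrix.aeval_self_charpoly, map_zero]
  · refine isUnit_aeval_of_forall_root _ A.charpoly_monic.ne_zero fun r hr hr' => ?_
    exact hA r (Matrix.mem_spectrum_iff_isRoot_charpoly.2 hr)
      (norm_eq_one_of_mem_spectrum h1 U hU hU' hr')

section Shadowing

open BoundedContinuousFunction

variable {Y : Type*} {d : ℕ}

section Operators

variable [TopologicalSpace Y] [DiscreteTopology Y]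

/-- Composition with a self-map of a discrete space, as an operator on bounded functions. -/
noncomputable def compOperator (σ : Y → Y) : (Y →ᵇ (Fin d → ℂ)) →L[ℂ] (Y →ᵇ (Fin d → ℂ)) :=
  LinearMap.mkContinuous
    { toFun := fun u => u.compContinuous ⟨σ, continuous_of_discreteTopology⟩
      map_add' := fun _ _ => rfl
      map_smul' := fun _ _ => rfl } 1 fun u => by
    rw [one_mul]
    exact (norm_le (norm_nonneg _)).2 fun y => u.norm_coe_le_norm _

theorem norm_compOperator_le (σ : Y → Y) : ‖compOperator (d := d) σ‖ ≤ 1 :=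
  LinearMap.mkContinuous_norm_le _ zero_le_one _

/-- Composition with a permutation of a discrete space, as a unit. -/
noncomputable def compUnit (σ : Y ≃ Y) : ((Y →ᵇ (Fin d → ℂ)) →L[ℂ] (Y →ᵇ (Fin d → ℂ)))ˣ where
  val := compOperator σ
  inv := compOperator σ.symm
  val_inv := by
    ext u y
    exact congrArg (fun z => u z _) (σ.symm_apply_apply y)
  inv_val := by
    ext u y
    exact congrArg (fun z => u z _) (σ.apply_symm_apply y)

/-- The action of square matrices on bounded vector-valued functions. -/
noncomputable def matrixOperator :
    Matrix (Fin d) (Fin d) ℂ →ₐ[ℂ] ((Y →ᵇ (Fin d → ℂ)) →L[ℂ] (Y →ᵇ (Fin d → ℂ))) where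
  toFun A := (LinearMap.toContinuousLinearMap (Matrix.toLin' A)).compLeftContinuousBounded Y
  map_one' := by
    ext u y
    simp
  map_mul' A B := by
    ext u y
    simp
  map_zero' := by
    ext u y
    simp
  map_add' A B := by
    ext u y
    simp
  commutes' r := by
    ext u y i
    simp [Algebra.algebraMap_eq_smul_one]

end Operators

theorem isUnit_compUnit_sub_matrixOperator [TopologicalSpace Y] [DiscreteTopology Y] (σ : Y ≃ Y)
    {A : Matrix (Fin d) (Fin d) ℂ} (hA : ∀ μ ∈ spectrum ℂ A, ‖μ‖ ≠ 1) :
    IsUnit ((compUnit σ).1 - matrixOperator (Y := Y) A) :=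
  isUnit_sub_algHom (R := (Y →ᵇ (Fin d → ℂ)) →L[ℂ] (Y →ᵇ (Fin d → ℂ)))
    ContinuousLinearMap.norm_id_le (compUnit σ) (norm_compOperator_le _)
    (norm_compOperator_le _) matrixOperator hA (ContinuousLinearMap.ext fun _ => rfl)

/-- If `A` has no eigenvalue of absolute value one then the equation `u ∘ σ - A u = v` has a
unique bounded solution `u` for every bounded `v`. -/
theorem bijective_comp_sub_mulVec (σ : Y ≃ Y) {A : Matrix (Fin d) (Fin d) ℂ}
    (hA : ∀ μ ∈ spectrum ℂ A, ‖μ‖ ≠ 1) :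
    (∀ u : Y → Fin d → ℂ, (∃ c, ∀ y, ‖u y‖ ≤ c) → (∀ y, u (σ y) = A.mulVec (u y)) →
      ∀ y, u y = 0) ∧
    ∀ v : Y → Fin d → ℂ, (∃ c, ∀ y, ‖v y‖ ≤ c) →
      ∃ u : Y → Fin d → ℂ, (∃ c, ∀ y, ‖u y‖ ≤ c) ∧ ∀ y, u (σ y) - A.mulVec (u y) = v y := by
  let _ : TopologicalSpace Y := ⊥
  have : DiscreteTopology Y := ⟨rfl⟩
  have hbij := ContinuousLinearMap.isUnit_iff_bijective.1 (isUnit_compUnit_sub_matrixOperator σ hA)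
  constructor
  · rintro u ⟨c, hc⟩ hu y
    have h0 : ofNormedAddCommGroupDiscrete u c hc = 0 := by
      refine hbij.1 ?_
      rw [map_zero]
      ext y : 1
      exact sub_eq_zero.2 (hu y)
    exact congrArg (fun w : Y →ᵇ (Fin d → ℂ) => w y) h0
  · rintro v ⟨c, hc⟩
    obtain ⟨u, hu⟩ := hbij.2 (ofNormedAddCommGroupDiscrete v c hc)
    exact ⟨u, ⟨‖u‖, u.norm_coe_le_norm⟩, fun y =>
      congrArg (fun w : Y →ᵇ (Fin d → ℂ) => w y) hu⟩

end Shadowing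

section RealShadowing

variable {Y : Type*} {d : ℕ} (σ : Y ≃ Y) {β : (Fin d → ℤ) ≃+ (Fin d → ℤ)}

/-- The coordinatewise inclusion of `ℝᵈ` into `ℂᵈ`. -/
def toComplex (v : Fin d → ℝ) : Fin d → ℂ := fun i => v i

theorem norm_toComplex (v : Fin d → ℝ) : ‖toComplex v‖ = ‖v‖ := by
  simp [toComplex, Pi.norm_def]

theorem toComplex_injective : Function.Injective (toComplex (d := d)) := fun v w h =>
  funext fun i => by simpa [toComplex] using congrFun h i

theorem mulVec_toComplex (v : Fin d → ℝ) :
    ((intMatrix β).map (Int.cast : ℤ → ℂ)).mulVec (toComplex v) = toComplex (realAut β v) := by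
  ext i
  simp [toComplex, realAut_apply, Matrix.mulVec, dotProduct]

theorem eq_zero_of_comp_eq_realAut
    (hβ : ∀ μ ∈ spectrum ℂ ((intMatrix β).map (Int.cast : ℤ → ℂ)), ‖μ‖ ≠ 1) {u : Y → Fin d → ℝ}
    {c : ℝ} (hc : ∀ y, ‖u y‖ ≤ c) (hu : ∀ y, u (σ y) = realAut β (u y)) (y : Y) : u y = 0 := by
  refine toComplex_injective ?_
  refine ((bijective_comp_sub_mulVec σ hβ).1 (fun y => toComplex (u y)) ⟨c, fun y => ?_⟩
    (fun y => ?_) y).trans ?_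
  · rw [norm_toComplex]
    exact hc y
  · rw [mulVec_toComplex, hu]
  · ext i
    simp [toComplex]

theorem exists_comp_sub_realAut_eq
    (hβ : ∀ μ ∈ spectrum ℂ ((intMatrix β).map (Int.cast : ℤ → ℂ)), ‖μ‖ ≠ 1) {v : Y → Fin d → ℝ}
    {c : ℝ} (hc : ∀ y, ‖v y‖ ≤ c) :
    ∃ u : Y → Fin d → ℝ, (∃ c, ∀ y, ‖u y‖ ≤ c) ∧ ∀ y, u (σ y) - realAut β (u y) = v y := by
  obtain ⟨u, ⟨c', hc'⟩, hu⟩ := (bijective_comp_sub_mulVec σ hβ).2 (fun y => toComplex (v y))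
    ⟨c, fun y => by rw [norm_toComplex]; exact hc y⟩
  refine ⟨fun y i => (u y i).re, ⟨c', fun y => ?_⟩, fun y => ?_⟩
  · refine (pi_norm_le_iff_of_nonneg ((norm_nonneg _).trans (hc' y))).2 fun i => ?_
    exact (Complex.abs_re_le_norm _).trans ((norm_le_pi_norm (u y) i).trans (hc' y))
  · ext i
    have := congrArg Complex.re (congrFun (hu y) i)
    simpa [toComplex, realAut_apply, Matrix.mulVec, dotProduct] using this

end RealShadowing

/-! ### Expansive linear automorphisms -/

section Expansive

variable {d : ℕ}

/-- A linear automorphism is expansive if zero is its only bounded two-sided orbit. -/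
def IsExpansive (A : (Fin d → ℝ) ≃ₗ[ℝ] (Fin d → ℝ)) : Prop :=
  ∀ v, (∃ r, ∀ n : ℤ, ‖(A ^ n) v‖ ≤ r) → v = 0

/-- The vectors with bounded forward orbit. -/
def forwardBounded (A : (Fin d → ℝ) ≃ₗ[ℝ] (Fin d → ℝ)) : Submodule ℝ (Fin d → ℝ) where
  carrier := {v | ∃ r, ∀ᶠ n : ℕ in atTop, ‖(A ^ n) v‖ ≤ r}
  add_mem' := by
    rintro v w ⟨r, hr⟩ ⟨s, hs⟩
    refine ⟨r + s, ?_⟩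
    filter_upwards [hr, hs] with n h1 h2
    rw [map_add]
    exact (norm_add_le _ _).trans (add_le_add h1 h2)
  zero_mem' := ⟨0, by simp⟩
  smul_mem' := by
    rintro a v ⟨r, hr⟩
    refine ⟨‖a‖ * r, ?_⟩
    filter_upwards [hr] with n h
    rw [map_smul, norm_smul]
    exact mul_le_mul_of_nonneg_left h (norm_nonneg _)

variable {A : (Fin d → ℝ) ≃ₗ[ℝ] (Fin d → ℝ)}

theorem IsExpansive.inv (hA : IsExpansive A) : IsExpansive A⁻¹ := by
  rintro v ⟨r, hr⟩
  refine hA v ⟨r, fun n => ?_⟩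
  have := hr (-n)
  rwa [inv_zpow', neg_neg] at this

theorem zpow_add_apply (A : (Fin d → ℝ) ≃ₗ[ℝ] (Fin d → ℝ)) (m n : ℤ) (v : Fin d → ℝ) :
    (A ^ (m + n)) v = (A ^ m) ((A ^ n) v) := by
  rw [zpow_add]
  rfl

theorem zpow_mem_forwardBounded {v : Fin d → ℝ} (hv : v ∈ forwardBounded A) (j : ℤ) :
    (A ^ j) v ∈ forwardBounded A := by
  obtain ⟨r, hr⟩ := hv
  obtain ⟨N, hN⟩ := eventually_atTop.1 hr
  refine ⟨r, eventually_atTop.2 ⟨N + j.natAbs, fun n hn => ?_⟩⟩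
  have h1 := hN (n + j).toNat (by omega)
  rw [← zpow_natCast, Int.toNat_of_nonneg (by omega), zpow_add_apply, zpow_natCast] at h1
  exact h1

/-- An expansive automorphism allows no nonzero limit of vectors all of whose images are
eventually bounded by a common constant. -/
theorem IsExpansive.tendsto_zero (hA : IsExpansive A) {Y : Type*} {l : Filter Y}
    {u : Y → Fin d → ℝ} {r : ℝ} (hu : ∀ j : ℤ, ∀ᶠ y in l, ‖(A ^ j) (u y)‖ ≤ r) :
    Tendsto u l (𝓝 0) := by
  rw [tendsto_iff_ultrafilter]
  intro g hg
  have h0 : ∀ᶠ y in (g : Filter Y), u y ∈ Metric.closedBall 0 r := by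
    filter_upwards [hg (hu 0)] with y hy
    rw [mem_closedBall_zero_iff]
    exact hy
  obtain ⟨z, -, hz⟩ := (isCompact_closedBall (0 : Fin d → ℝ) r).ultrafilter_le_nhds (g.map u)
    (le_principal_iff.2 h0)
  have hz' : Tendsto u g (𝓝 z) := hz
  suffices z = 0 by rwa [this] at hz'
  refine hA z ⟨r, fun j => ?_⟩
  have h1 := ((A ^ j).toLinearMap.continuous_of_finiteDimensional.tendsto z).comp hz'
  exact le_of_tendsto h1.norm (hg (hu j))

theorem IsExpansive.tendsto_pow (hA : IsExpansive A) {v : Fin d → ℝ} (hv : v ∈ forwardBounded A) :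
    Tendsto (fun n : ℕ => (A ^ n) v) atTop (𝓝 0) := by
  obtain ⟨r, hr⟩ := hv
  obtain ⟨N, hN⟩ := eventually_atTop.1 hr
  refine hA.tendsto_zero (r := r) fun j => eventually_atTop.2 ⟨N + j.natAbs, fun n hn => ?_⟩
  have h1 := hN (j + n).toNat (by omega)
  rw [← zpow_natCast, Int.toNat_of_nonneg (by omega), zpow_add_apply, zpow_natCast] at h1
  exact h1

theorem exists_forall_norm_pow_le {v : Fin d → ℝ} (hv : v ∈ forwardBounded A) :
    ∃ r, ∀ n : ℕ, ‖(A ^ n) v‖ ≤ r := by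
  obtain ⟨r, hr⟩ := hv
  obtain ⟨s, hs⟩ := (isBoundedUnder_of_eventually_le hr).bddAbove_range
  exact ⟨s, fun n => hs ⟨n, rfl⟩⟩

theorem IsExpansive.disjoint (hA : IsExpansive A) :
    Disjoint (forwardBounded A⁻¹) (forwardBounded A) := by
  rw [Submodule.disjoint_def]
  intro v h1 h2
  obtain ⟨r, hr⟩ := exists_forall_norm_pow_le h1
  obtain ⟨s, hs⟩ := exists_forall_norm_pow_le h2
  refine hA v ⟨max r s, fun n => ?_⟩
  obtain ⟨n, rfl | rfl⟩ := n.eq_nat_or_neg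
  · exact (hs n).trans (le_max_right _ _)
  · rw [← inv_zpow', zpow_natCast]
    exact (hr n).trans (le_max_left _ _)

theorem tendsto_apply_of_bounded {S : ℕ → (Fin d → ℝ) →ₗ[ℝ] (Fin d → ℝ)}
    (hS : ∀ v, Tendsto (fun n => S n v) atTop (𝓝 0)) {w : ℕ → Fin d → ℝ} {r : ℝ}
    (hw : ∀ n, ‖w n‖ ≤ r) : Tendsto (fun n => S n (w n)) atTop (𝓝 0) := by
  have h1 : ∀ n, S n (w n) = ∑ i, w n i • S n (fun j => if i = j then 1 else 0) := fun n =>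
    LinearMap.pi_apply_eq_sum_univ _ _
  simp_rw [h1]
  rw [show (0 : Fin d → ℝ) = ∑ _i : Fin d, 0 by simp]
  refine tendsto_finsetSum _ fun i _ => ?_
  refine (isBoundedUnder_of ⟨r, fun n => ?_⟩).smul_tendsto_zero (hS _)
  exact (norm_le_pi_norm (w n) i).trans (hw n)

/-- The approximation of a vector `z` by images of integral vectors under the contracting maps
`A⁻ⁿ` on the expanding subspace and `Aⁿ` on the contracting subspace. -/
theorem IsExpansive.exists_tendsto (hA : IsExpansive A)
    (htop : forwardBounded A⁻¹ ⊔ forwardBounded A = ⊤) (z : Fin d → ℝ) :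
    ∃ (v : ℕ → Fin d → ℤ) (a b : ℕ → Fin d → ℝ), (∀ n, a n ∈ forwardBounded A⁻¹) ∧
      (∀ n, b n ∈ forwardBounded A) ∧ (∀ n, a n + b n = toReal (v n)) ∧
      Tendsto (fun n => (A⁻¹ ^ n) (a n) + (A ^ n) (b n)) atTop (𝓝 z) := by
  have hc : IsCompl (forwardBounded A⁻¹) (forwardBounded A) :=
    ⟨hA.disjoint, codisjoint_iff.2 htop⟩
  set P := (forwardBounded A⁻¹).projection _ hc
  set Q := (forwardBounded A).projection _ hc.symm
  have hPmem : ∀ v, P v ∈ forwardBounded A⁻¹ := fun v => Submodule.projection_apply_mem hc v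
  have hQmem : ∀ v, Q v ∈ forwardBounded A := fun v => Submodule.projection_apply_mem hc.symm v
  have hPQ : ∀ v, P v + Q v = v := fun v => Submodule.projection_add_projection_eq_self hc v
  have hinv : ∀ n : ℕ, A⁻¹ ^ n = A ^ (-(n : ℤ)) := fun n => by rw [inv_pow, zpow_neg, zpow_natCast]
  have hw : ∀ n : ℕ, ∃ v : Fin d → ℤ, ‖toReal v - ((A ^ n) (P z) + (A⁻¹ ^ n) (Q z))‖ ≤ 1 :=
    fun n => exists_norm_toReal_sub_le _
  choose v hv using hw
  set δ := fun n => toReal (v n) - ((A ^ n) (P z) + (A⁻¹ ^ n) (Q z))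
  refine ⟨v, fun n => P (δ n) + (A ^ n) (P z), fun n => Q (δ n) + (A⁻¹ ^ n) (Q z), fun n => ?_,
    fun n => ?_, fun n => ?_, ?_⟩
  · refine add_mem (hPmem _) ?_
    have := zpow_mem_forwardBounded (hPmem z) (-n)
    rwa [inv_zpow', neg_neg, zpow_natCast] at this
  · refine add_mem (hQmem _) ?_
    rw [hinv]
    exact zpow_mem_forwardBounded (hQmem z) _
  · rw [add_add_add_comm, hPQ, sub_add_cancel]
  · have h1 := tendsto_apply_of_bounded (S := fun n => (A⁻¹ ^ n).toLinearMap ∘ₗ P)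
      (fun v => hA.inv.tendsto_pow (hPmem v)) hv
    have h2 := tendsto_apply_of_bounded (S := fun n => (A ^ n).toLinearMap ∘ₗ Q)
      (fun v => hA.tendsto_pow (hQmem v)) hv
    have h3 := (h1.add h2).add_const z
    rw [add_zero, zero_add] at h3
    refine h3.congr fun n => ?_
    have h4 : (A⁻¹ ^ n) ((A ^ n) (P z)) = P z := by
      rw [inv_pow]
      exact (A ^ n).symm_apply_apply _
    have h5 : (A ^ n) ((A⁻¹ ^ n) (Q z)) = Q z := by
      rw [inv_pow]
      exact (A ^ n).apply_symm_apply _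
    change (A⁻¹ ^ n) (P (δ n)) + (A ^ n) (Q (δ n)) + z = _
    rw [map_add, map_add, h4, h5, add_add_add_comm, hPQ]

theorem eq_top_of_forall_toReal_mem {S : Submodule ℝ (Fin d → ℝ)} (h : ∀ v, toReal v ∈ S) :
    S = ⊤ := by
  rw [eq_top_iff, ← (Pi.basisFun ℝ (Fin d)).span_eq, Submodule.span_le]
  rintro _ ⟨i, rfl⟩
  have : Pi.basisFun ℝ (Fin d) i = toReal (Pi.single i 1) := by
    ext j
    simp [toReal, Pi.single_apply]
  rw [this]
  exact h _

theorem zpow_realAut_toReal (β : (Fin d → ℤ) ≃+ (Fin d → ℤ)) (n : ℤ) (v : Fin d → ℤ) :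
    ∃ w, (realAut β ^ n) (toReal v) = toReal w := by
  have key : ∀ (β : (Fin d → ℤ) ≃+ (Fin d → ℤ)) (n : ℕ),
      ∃ w, (realAut β ^ n) (toReal v) = toReal w := fun β n => by
    induction n with
    | zero => exact ⟨v, rfl⟩
    | succ n ih =>
      obtain ⟨w, hw⟩ := ih
      refine ⟨β w, ?_⟩
      rw [pow_succ', LinearEquiv.mul_apply, hw, realAut_toReal]
  obtain ⟨n, rfl | rfl⟩ := n.eq_nat_or_neg
  · exact key β n
  · rw [← inv_zpow', zpow_natCast]
    exact key β.symm n

theorem isExpansive_realAut {β : (Fin d → ℤ) ≃+ (Fin d → ℤ)}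
    (hβ : ∀ μ ∈ spectrum ℂ ((intMatrix β).map (Int.cast : ℤ → ℂ)), ‖μ‖ ≠ 1) :
    IsExpansive (realAut β) := by
  rintro v ⟨r, hr⟩
  refine eq_zero_of_comp_eq_realAut (Equiv.addRight (1 : ℤ)) hβ hr (fun n => ?_) 0
  change (realAut β ^ (n + 1)) v = _
  rw [add_comm, zpow_add_apply, zpow_one]

end Expansive

/-! ### Linearization of a lift -/

/-- A linearization of the self-homeomorphism `F` of `M` by a linear automorphism `A`: a map that
conjugates `F` to `A` and is at bounded distance from the coarse coordinate. -/
structure IsLinearization {d : ℕ} [TopologicalSpace M] (A : (Fin d → ℝ) ≃ₗ[ℝ] (Fin d → ℝ))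
    (k : M → Fin d → ℤ) (F : M ≃ₜ M) (Φ : M → Fin d → ℝ) : Prop where
  semiconj : ∀ x, Φ (F x) = A (Φ x)
  bound : ∃ c, ∀ x, ‖Φ x - toReal (k x)‖ ≤ c

section General

variable {d : ℕ} [TopologicalSpace M] {A : (Fin d → ℝ) ≃ₗ[ℝ] (Fin d → ℝ)} {k : M → Fin d → ℤ}
  {F : M ≃ₜ M} {Φ : M → Fin d → ℝ}

theorem IsLinearization.inv (h : IsLinearization A k F Φ) : IsLinearization A⁻¹ k F⁻¹ Φ where
  semiconj x := by
    have h1 := h.semiconj (F⁻¹ x)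
    have h2 : F (F⁻¹ x) = x := F.apply_symm_apply x
    rw [h2] at h1
    rw [h1]
    exact (A.symm_apply_apply _).symm
  bound := h.bound

theorem IsLinearization.semiconj_pow (h : IsLinearization A k F Φ) (n : ℕ) (x : M) :
    Φ ((F ^ n) x) = (A ^ n) (Φ x) := by
  induction n with
  | zero => rfl
  | succ n ih =>
    rw [pow_succ', pow_succ', LinearEquiv.mul_apply, ← ih, ← h.semiconj]
    rfl

theorem IsLinearization.semiconj_zpow (h : IsLinearization A k F Φ) (n : ℤ) (x : M) :
    Φ ((F ^ n) x) = (A ^ n) (Φ x) := by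
  obtain ⟨n, rfl | rfl⟩ := n.eq_nat_or_neg
  · rw [zpow_natCast, zpow_natCast, h.semiconj_pow]
  · rw [← inv_zpow', ← inv_zpow', zpow_natCast, zpow_natCast, h.inv.semiconj_pow]

theorem IsLinearization.exists_norm_sub_le (h : IsLinearization A k F Φ) :
    ∃ c, ∀ x y, ‖Φ x - Φ y‖ ≤ ‖k x - k y‖ + c ∧ ‖k x - k y‖ ≤ ‖Φ x - Φ y‖ + c := by
  obtain ⟨c, hc⟩ := h.bound
  refine ⟨c + c, fun x y => ?_⟩
  have h1 : ‖(Φ x - Φ y) - toReal (k x - k y)‖ ≤ c + c := by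
    rw [toReal_sub, sub_sub_sub_comm]
    exact (norm_sub_le _ _).trans (add_le_add (hc x) (hc y))
  have h2 := abs_le.1 ((abs_norm_sub_norm_le _ _).trans h1)
  rw [norm_toReal] at h2
  constructor <;> linarith

/-- Nearby points have nearby orbits in the coarse sense, for any finite time; so the difference
of their images under the linearization has only the limit zero. -/
theorem IsLinearization.continuous {D : DirectProductStructure M} {π : M → X}
    {e : deckGroup D π ≃* Multiplicative (Fin d → ℤ)} (hk : IsCoarseCoord e k)
    (hA : IsExpansive A) (hΦ : IsLinearization A k F Φ) : Continuous Φ := by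
  obtain ⟨r, hr⟩ := hk.locally_bounded
  obtain ⟨c, hc⟩ := hΦ.exists_norm_sub_le
  refine continuous_iff_continuousAt.2 fun x => ?_
  rw [ContinuousAt, ← tendsto_sub_nhds_zero_iff]
  refine hA.tendsto_zero (r := r + c) fun j => ?_
  filter_upwards [(F ^ j).continuous.continuousAt.eventually (hr ((F ^ j) x))] with y hy
  rw [map_sub, ← hΦ.semiconj_zpow, ← hΦ.semiconj_zpow]
  exact (hc _ _).1.trans (by gcongr)

end General

section Lift

variable [TopologicalSpace X] [TopologicalSpace M] {f : X ≃ₜ X} {D : DirectProductStructure M}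
  {π : M → X} {d : ℕ} {e : deckGroup D π ≃* Multiplicative (Fin d → ℤ)} {k : M → Fin d → ℤ}
  {F : M ≃ₜ M} {Φ : M → Fin d → ℝ}

/-- The correction of the coarse coordinate to a linearization is the bounded solution of the
shadowing equation for the bounded error of the coarse coordinate. -/
theorem IsCoarseCoord.exists_isLinearization (hk : IsCoarseCoord e k) (hF : IsLift f D π F)
    (hA : IsHyperbolic (autMatrix e (inducedAut hF))) :
    ∃ Φ, IsLinearization (realAut (latticeAut e (inducedAut hF))) k F Φ := by
  obtain ⟨c, hc⟩ := hk.exists_lift_bound hF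
  obtain ⟨u, hub, hu⟩ := exists_comp_sub_realAut_eq F.toEquiv
    (β := latticeAut e (inducedAut hF)) hA.2
    (v := fun y => realAut (latticeAut e (inducedAut hF)) (toReal (k y)) - toReal (k (F y)))
    (c := c) fun y => by
      rw [realAut_toReal, ← toReal_sub, norm_toReal, norm_sub_rev]
      exact hc y
  refine ⟨fun x => toReal (k x) + u x, fun x => ?_, ?_⟩
  · have := hu x
    change u (F x) - _ = _ at this
    rw [map_add, eq_add_of_sub_eq this]
    abel
  · simpa using hub

theorem IsLinearization.map_deck (hk : IsCoarseCoord e k) {hF : IsLift f D π F}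
    (hA : IsHyperbolic (autMatrix e (inducedAut hF)))
    (hΦ : IsLinearization (realAut (latticeAut e (inducedAut hF))) k F Φ) (g : deckGroup D π)
    (x : M) : Φ (g.1 x) = toReal (deckVec e g) + Φ x := by
  obtain ⟨c, hc⟩ := hΦ.bound
  -- the defect is bounded and conjugated to its image under the linear map
  have := eq_zero_of_comp_eq_realAut ((inducedAut hF).toEquiv.prodCongr F.toEquiv)
    (β := latticeAut e (inducedAut hF)) hA.2
    (u := fun p => Φ (p.1.1 p.2) - (toReal (deckVec e p.1) + Φ p.2)) (c := c + c) ?_ ?_ (g, x)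
  · exact sub_eq_zero.1 this
  · rintro ⟨g, x⟩
    have h1 := norm_sub_le (Φ (g.1 x) - toReal (k (g.1 x))) (Φ x - toReal (k x))
    rw [hk.map_deck, toReal_add] at h1
    have h2 : Φ (g.1 x) - (toReal (deckVec e g) + toReal (k x)) - (Φ x - toReal (k x)) =
      Φ (g.1 x) - (toReal (deckVec e g) + Φ x) := by abel
    rw [h2, ← toReal_add, ← hk.map_deck] at h1
    exact h1.trans (add_le_add (hc _) (hc _))
  · rintro ⟨g, x⟩
    change Φ ((inducedAut hF g).1 (F x)) - (toReal (deckVec e (inducedAut hF g)) + Φ (F x)) = _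
    rw [← hF.apply_deck, hΦ.semiconj, hΦ.semiconj, ← latticeAut_deckVec, ← realAut_toReal,
      map_sub, map_add]

end Lift

section Metric

variable [MetricSpace X] [CompactSpace X] [LocallyConnectedSpace X] [TopologicalSpace M]
  {f : X ≃ₜ X} {L : LocalProductStructure X} {lam C : ℝ} {D : DirectProductStructure M}
  {π : M → X} {d : ℕ} {e : deckGroup D π ≃* Multiplicative (Fin d → ℤ)} {k : M → Fin d → ℤ}
  {F : M ≃ₜ M} {Φ : M → Fin d → ℝ} {A : (Fin d → ℝ) ≃ₗ[ℝ] (Fin d → ℝ)}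

theorem SmaleMetric.linearization_injective (hf : SmaleMetric f L lam C)
    (hπ : IsSplitting f L D π) (hk : IsCoarseCoord e k) (hF : IsLift f D π F)
    (hΦ : IsLinearization A k F Φ) : Function.Injective Φ := by
  intro x y hxy
  obtain ⟨c, hc⟩ := hΦ.exists_norm_sub_le
  refine hf.eq_of_coarse_bounded hπ hk hF (r := c) fun n => ?_
  have := (hc ((F ^ n) x) ((F ^ n) y)).2
  rwa [hΦ.semiconj_zpow, hΦ.semiconj_zpow, hxy, sub_self, norm_zero, zero_add] at this

theorem SmaleMetric.sub_mem_forwardBounded (hf : SmaleMetric f L lam C)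
    (hπ : IsSplitting f L D π) (hk : IsCoarseCoord e k) (hF : IsLift f D π F)
    (hΦ : IsLinearization A k F Φ) {x y : M} (hxy : D.br x y = x) :
    Φ x - Φ y ∈ forwardBounded A := by
  obtain ⟨c, hc⟩ := hΦ.exists_norm_sub_le
  obtain ⟨r, H⟩ := hf.exists_coarse_contraction hπ hk hF
  obtain ⟨n₀, hn₀⟩ := H ‖k x - k y‖
  refine ⟨r + c, eventually_atTop.2 ⟨n₀, fun n hn => ?_⟩⟩
  rw [map_sub, ← hΦ.semiconj_pow, ← hΦ.semiconj_pow]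
  exact (hc _ _).1.trans (by gcongr; exact hn₀ x y hxy le_rfl n hn)

/-- If a lattice vector is the sum of an expanding vector `a` and a contracting vector `b` then the
image of the linearization is invariant under the translations by `a` and by `b`: they are realized
by the action of a deck transformation on one of the two factors of `M`. -/
theorem SmaleMetric.exists_linearization_eq_add (hf : SmaleMetric f L lam C)
    (hπ : IsSplitting f L D π) (hk : IsCoarseCoord e k) (hF : IsLift f D π F)
    (hA : IsExpansive A) (hΦ : IsLinearization A k F Φ)
    (hdeck : ∀ (g : deckGroup D π) x, Φ (g.1 x) = toReal (deckVec e g) + Φ x)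
    {a b : Fin d → ℝ} (ha : a ∈ forwardBounded A⁻¹) (hb : b ∈ forwardBounded A)
    {v : Fin d → ℤ} (hv : a + b = toReal v) (x : M) :
    (∃ y, Φ y = Φ x + a) ∧ ∃ y, Φ y = Φ x + b := by
  obtain ⟨g, rfl⟩ := deckVec_surjective e v
  have hs : ∀ {x y : M}, D.br x y = x → Φ x - Φ y ∈ forwardBounded A := fun h =>
    hf.sub_mem_forwardBounded hπ hk hF hΦ h
  have hu : ∀ {x y : M}, D.br y x = x → Φ x - Φ y ∈ forwardBounded A⁻¹ := fun h =>
    hf.swap.sub_mem_forwardBounded hπ.swap hk.swap hF.swap hΦ.inv h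
  have huniq : ∀ {a' b' : Fin d → ℝ}, a' ∈ forwardBounded A⁻¹ → b' ∈ forwardBounded A →
      a' + b' = a + b → a' = a ∧ b' = b := by
    intro a' b' ha' hb' h
    have h1 : a' - a = b - b' := by
      rw [sub_eq_sub_iff_add_eq_add, h, add_comm]
    have h2 := Submodule.disjoint_def.1 hA.disjoint (a' - a) (sub_mem ha' ha)
      (h1 ▸ sub_mem hb hb')
    refine ⟨sub_eq_zero.1 h2, ?_⟩
    rw [h1] at h2
    exact (sub_eq_zero.1 h2).symm
  refine ⟨⟨D.br x (g.1 x), ?_⟩, ⟨D.br (g.1 x) x, ?_⟩⟩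
  · have h1 := huniq (a' := Φ (D.br x (g.1 x)) - Φ x) (b' := Φ (g.1 x) - Φ (D.br x (g.1 x)))
      (hu (by simp)) (neg_sub (Φ (D.br x (g.1 x))) (Φ (g.1 x)) ▸ neg_mem (hs (by simp)))
      (by rw [hv, hdeck]; abel)
    rw [← h1.1, add_sub_cancel]
  · have h1 := huniq (a' := Φ (g.1 x) - Φ (D.br (g.1 x) x)) (b' := Φ (D.br (g.1 x) x) - Φ x)
      (hu (by simp)) (neg_sub (Φ x) (Φ (D.br (g.1 x) x)) ▸ neg_mem (hs (by simp)))
      (by rw [hv, hdeck]; abel)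
    rw [← h1.2, add_sub_cancel]

theorem SmaleMetric.linearization_surjective [Nonempty M] (hf : SmaleMetric f L lam C)
    (hπ : IsSplitting f L D π) (hk : IsCoarseCoord e k) (hF : IsLift f D π F)
    (hA : IsHyperbolic (autMatrix e (inducedAut hF)))
    (hΦ : IsLinearization (realAut (latticeAut e (inducedAut hF))) k F Φ) :
    Function.Surjective Φ := by
  have hexp : IsExpansive (realAut (latticeAut e (inducedAut hF))) := isExpansive_realAut hA.2
  have hdeck := hΦ.map_deck hk hA
  obtain ⟨x₀⟩ := ‹Nonempty M›
  set A := realAut (latticeAut e (inducedAut hF))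
  have htop : forwardBounded A⁻¹ ⊔ forwardBounded A = ⊤ := by
    refine eq_top_of_forall_toReal_mem fun v => ?_
    obtain ⟨g, rfl⟩ := deckVec_surjective e v
    have h1 : Φ (D.br x₀ (g.1 x₀)) - Φ x₀ ∈ forwardBounded A⁻¹ :=
      hf.swap.sub_mem_forwardBounded hπ.swap hk.swap hF.swap hΦ.inv (x := D.br x₀ (g.1 x₀))
        (D.br_br_right x₀ x₀ (g.1 x₀))
    have h2 : Φ (D.br x₀ (g.1 x₀)) - Φ (g.1 x₀) ∈ forwardBounded A :=
      hf.sub_mem_forwardBounded hπ hk hF hΦ (by simp)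
    have h3 : toReal (deckVec e g) = (Φ (D.br x₀ (g.1 x₀)) - Φ x₀) +
        -(Φ (D.br x₀ (g.1 x₀)) - Φ (g.1 x₀)) := by
      rw [hdeck]
      abel
    rw [h3]
    exact Submodule.add_mem_sup h1 (neg_mem h2)
  intro y
  obtain ⟨v, a, b, ha, hb, hab, hlim⟩ := hexp.exists_tendsto htop (y - Φ x₀)
  -- the two halves of lattice vectors stay halves of lattice vectors under powers of `A`
  have hmem : ∀ n, ∃ x, Φ x = Φ x₀ + ((A⁻¹ ^ n) (a n) + (A ^ n) (b n)) := by
    intro n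
    have hinv : A⁻¹ ^ n = A ^ (-(n : ℤ)) := by rw [inv_pow, zpow_neg, zpow_natCast]
    obtain ⟨w, hw⟩ := zpow_realAut_toReal (latticeAut e (inducedAut hF)) (-n) (v n)
    obtain ⟨w', hw'⟩ := zpow_realAut_toReal (latticeAut e (inducedAut hF)) n (v n)
    have hua : ∀ j : ℤ, (A ^ j) (a n) ∈ forwardBounded A⁻¹ := fun j => by
      have := zpow_mem_forwardBounded (ha n) (-j)
      rwa [inv_zpow', neg_neg] at this
    have hsb : ∀ j : ℤ, (A ^ j) (b n) ∈ forwardBounded A := zpow_mem_forwardBounded (hb n)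
    rw [← hab, map_add] at hw hw'
    obtain ⟨x₁, hx₁⟩ :=
      (hf.exists_linearization_eq_add hπ hk hF hexp hΦ hdeck (hua _) (hsb _) hw x₀).1
    obtain ⟨x₂, hx₂⟩ :=
      (hf.exists_linearization_eq_add hπ hk hF hexp hΦ hdeck (hua _) (hsb _) hw' x₁).2
    refine ⟨x₂, ?_⟩
    rw [hx₂, hx₁, hinv, ← zpow_natCast, add_assoc]
  choose x hx using hmem
  have hlim' : Tendsto (fun n => Φ (x n)) atTop (𝓝 y) := by
    have := hlim.const_add (Φ x₀)
    rw [add_sub_cancel] at this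
    exact this.congr fun n => (hx n).symm
  -- the image is closed since the linearization is proper
  obtain ⟨c, hc⟩ := hΦ.bound
  obtain ⟨Q, hQ, hkQ⟩ := hk.exists_isCompact (‖y‖ + 1 + c)
  have hQ' : ∀ᶠ n in atTop, Φ (x n) ∈ Φ '' Q := by
    filter_upwards [hlim'.norm.eventually_lt_const (lt_add_one ‖y‖)] with n hn
    refine ⟨x n, hkQ _ ?_, rfl⟩
    have h1 := norm_sub_norm_le (toReal (k (x n))) (Φ (x n))
    rw [norm_toReal, norm_sub_rev] at h1
    linarith [hc (x n)]
  obtain ⟨z, -, hz⟩ := (hQ.image (hΦ.continuous hk hexp)).isClosed.mem_of_tendsto hlim' hQ'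
  exact ⟨z, hz⟩

end Metric

/-! ### The conjugacy to a toral automorphism -/

section Torus

variable {d : ℕ}

/-- The projection of `ℝᵈ` onto the torus `ℝᵈ/ℤᵈ`. -/
def torusMk (y : Fin d → ℝ) : UnitAddTorus (Fin d) := fun i => (y i : UnitAddCircle)

theorem continuous_torusMk : Continuous (torusMk (d := d)) :=
  continuous_pi fun i => (AddCircle.continuous_mk' (1 : ℝ)).comp (continuous_apply i)

theorem torusMk_surjective : Function.Surjective (torusMk (d := d)) := fun t => by
  choose y hy using fun i => QuotientAddGroup.mk_surjective (t i)
  exact ⟨y, funext hy⟩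

theorem torusMk_toReal_add (v : Fin d → ℤ) (y : Fin d → ℝ) :
    torusMk (toReal v + y) = torusMk y := by
  ext i
  change ((v i + y i : ℝ) : UnitAddCircle) = (y i : UnitAddCircle)
  rw [AddCircle.coe_add, AddCircle.coe_eq_zero_iff 1 |>.2 ⟨v i, by simp⟩, zero_add]

theorem exists_eq_toReal_add_of_torusMk_eq {y z : Fin d → ℝ} (h : torusMk y = torusMk z) :
    ∃ v : Fin d → ℤ, y = toReal v + z := by
  have : ∀ i, ∃ n : ℤ, (n : ℝ) = y i - z i := fun i => by
    have h1 : ((y i - z i : ℝ) : UnitAddCircle) = 0 := by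
      rw [AddCircle.coe_sub]
      exact sub_eq_zero.2 (congrFun h i)
    obtain ⟨n, hn⟩ := (AddCircle.coe_eq_zero_iff 1).1 h1
    exact ⟨n, by simpa using hn⟩
  choose v hv using this
  exact ⟨v, funext fun i => by simp [toReal, hv]⟩

theorem toralMap_torusMk (β : (Fin d → ℤ) ≃+ (Fin d → ℤ)) (y : Fin d → ℝ) :
    toralMap (intMatrix β) (torusMk y) = torusMk (realAut β y) := by
  ext i
  have h1 : ∀ s : Finset (Fin d), ((∑ j ∈ s, (intMatrix β i j : ℝ) * y j : ℝ) : UnitAddCircle) =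
      ∑ j ∈ s, intMatrix β i j • (y j : UnitAddCircle) := fun s => by
    rw [← QuotientAddGroup.mk'_apply, map_sum]
    refine Finset.sum_congr rfl fun j _ => ?_
    rw [← zsmul_eq_mul, map_zsmul]
    rfl
  exact (h1 Finset.univ).symm

end Torus

/-- The linearization of a lift descends to a homeomorphism of `X` and the torus. -/
theorem SmaleMetric.exists_conjugacy [MetricSpace X] [CompactSpace X] [LocallyConnectedSpace X]
    [TopologicalSpace M] [Nonempty M] {f : X ≃ₜ X} {L : LocalProductStructure X} {lam C : ℝ}
    {D : DirectProductStructure M} {π : M → X} {d : ℕ}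
    {e : deckGroup D π ≃* Multiplicative (Fin d → ℤ)} {F : M ≃ₜ M}
    (hf : SmaleMetric f L lam C) (hπ : IsSplitting f L D π) (hF : IsLift f D π F)
    (hA : IsHyperbolic (autMatrix e (inducedAut hF))) :
    ∃ h : X ≃ₜ UnitAddTorus (Fin d),
      ∀ x : X, h (f x) = toralMap (autMatrix e (inducedAut hF)) (h x) := by
  obtain ⟨k, hk⟩ := hf.exists_isCoarseCoord hπ e
  obtain ⟨Φ, hΦ⟩ := hk.exists_isLinearization hF hA
  have hcont := hΦ.continuous hk (isExpansive_realAut hA.2)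
  have hdeck := hΦ.map_deck hk hA
  have hinj := hf.linearization_injective hπ hk hF hΦ
  have hsurj := hf.linearization_surjective hπ hk hF hA hΦ
  obtain ⟨σ, hσ⟩ := hπ.surjective.hasRightInverse
  have hH : ∀ p, torusMk (Φ (σ (π p))) = torusMk (Φ p) := fun p => by
    obtain ⟨g, hg⟩ := hf.exists_deck hπ (hσ (π p))
    rw [← hg, hdeck, torusMk_toReal_add]
  have hHc : Continuous fun x => torusMk (Φ (σ x)) := by
    rw [(hπ.isCoveringMap.isQuotientMap hπ.surjective).continuous_iff]
    exact (continuous_torusMk.comp hcont).congr fun p => (hH p).symm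
  have hbij : Function.Bijective fun x => torusMk (Φ (σ x)) := by
    constructor
    · intro x y hxy
      obtain ⟨v, hv⟩ := exists_eq_toReal_add_of_torusMk_eq hxy
      obtain ⟨g, rfl⟩ := deckVec_surjective e v
      rw [← hdeck] at hv
      rw [← hσ x, ← hσ y, hinj hv, g.2.2]
    · intro t
      obtain ⟨y, rfl⟩ := torusMk_surjective t
      obtain ⟨p, rfl⟩ := hsurj y
      exact ⟨π p, hH p⟩
  refine ⟨Continuous.homeoOfEquivCompactToT2 (f := Equiv.ofBijective _ hbij) hHc, fun x => ?_⟩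
  change torusMk (Φ (σ (f x))) = toralMap (intMatrix _) (torusMk (Φ (σ x)))
  rw [toralMap_torusMk, ← hΦ.semiconj, ← hH (F _), hF.semiconj, hσ]

end Smale

theorem mainTheorem7 {X M : Type*} [TopologicalSpace X] [TopologicalSpace M]
    [ConnectedSpace X] [LocallyConnectedSpace X]
    (f : X ≃ₜ X) (L : Smale.LocalProductStructure X) (hf : Smale.IsSmaleSpace f L)
    (D : Smale.DirectProductStructure M) (π : M → X) (hπ : Smale.IsSplitting f L D π)
    (d : ℕ) (e : Smale.deckGroup D π ≃* Multiplicative (Fin d → ℤ)) :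
    (∃ F : M ≃ₜ M, Smale.IsLift f D π F) ∧
    (∀ (F : M ≃ₜ M) (hF : Smale.IsLift f D π F),
      Smale.IsHyperbolic (Smale.autMatrix e (Smale.inducedAut hF)) ∧
      ∃ h : X ≃ₜ UnitAddTorus (Fin d),
        ∀ x : X, h (f x) = Smale.toralMap (Smale.autMatrix e (Smale.inducedAut hF)) (h x)) ∧
    ∃ x : X, f x = x := by
  obtain ⟨_, hpres, m, rfl, lam, C, hlam, hlam', hC, hchart⟩ := hf
  have hf : Smale.SmaleMetric f L lam C := ⟨hpres, hlam, hlam', hC, hchart⟩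
  have hM : Nonempty M := (hπ.surjective (Classical.arbitrary X)).nonempty
  have hlift : ∃ F : M ≃ₜ M, Smale.IsLift f D π F := by
    obtain ⟨p⟩ := hM
    obtain ⟨q, hq⟩ := hπ.surjective (f (π p))
    obtain ⟨F, hF, -⟩ := hf.exists_lift hπ (Commute.refl f) hpres hq
    exact ⟨F, hF⟩
  have hconj : ∀ (F : M ≃ₜ M) (hF : Smale.IsLift f D π F),
      Smale.IsHyperbolic (Smale.autMatrix e (Smale.inducedAut hF)) ∧
      ∃ h : X ≃ₜ UnitAddTorus (Fin d),
        ∀ x : X, h (f x) = Smale.toralMap (Smale.autMatrix e (Smale.inducedAut hF)) (h x) := by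
    intro F hF
    obtain ⟨k, hk⟩ := hf.exists_isCoarseCoord hπ e
    have hA := hf.isHyperbolic hπ hk hF
    exact ⟨hA, hf.exists_conjugacy hπ hF hA⟩
  refine ⟨hlift, hconj, ?_⟩
  -- the fixed point corresponds to the neutral element of the torus
  obtain ⟨F, hF⟩ := hlift
  obtain ⟨-, h, hh⟩ := hconj F hF
  refine ⟨h.symm 0, h.injective ?_⟩
  rw [hh, h.apply_symm_apply]
  ext i
  simp [Smale.toralMap]
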